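/- **Theorem 4.3.** Let $\mathbb S^1=\mathbb R/\mathbb Z$. Let $f:\mathbb R\to\mathbb R$ be a $C^\infty$ function with $\lim_{x\to\pm\infty}f(x)=+\infty$, and put $\hat\gamma_k(x)=(f'(x),\dots,f^{(k)}(x))\in\mathbb R^k$. Suppose that for both $k=2$ and $k=3$ the function $f$ is *$k$-good*: $\hat\gamma_k$ never vanishes, and $\hat\gamma_k$ maps no non-empty open interval into a hyperplane of $\mathbb R^k$ through the origin. Let $F:B^1\to B^0$, $F(u)(t)=u'(t)+f(u(t))$, where either $B^1=C^1(\mathbb S^1)$ and $B^0=C^0(\mathbb S^1)$, or $B^1=H^1(\mathbb S^1)$ (absolutely continuous functions on $\mathbb S^1$ with derivative in $L^2$) and $B^0=L^2(\mathbb S^1)$; all functions are real valued. Let $\tilde B^0=\{v\in B^0:\int_{\mathbb S^1}v=0\}$. Then, in each of the two cases: 1. If $0$ lies in the interior of the convex hull of $\hat\gamma_2(\mathbb R)\subset\mathbb R^2$, then $F$ has a cusp, i.e. a Morin singularity of order $2$: there are $u\in B^1$, a Banach space $X$, $C^\infty$ diffeomorphisms $e_1$ from a neighbourhood of $u$ in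 $B^1$ and $e_0$ from a neighbourhood of $F(u)$ in $B^0$ onto open subsets of $X\times\mathbb R$, and a $C^\infty$ function $\mu$ with $(e_0\circ F\circ e_1^{-1})(x,y)=(x,\mu(x,y))$ on the whole image of $e_1$, such that at the point $e_1(u)$ one has $\partial_y\mu=\partial_y^2\mu=0$, $\partial_y^3\mu\neq0$ and $D(\partial_y\mu)\neq0$. 2. Otherwise $F$ is a (differentiable) global fold: there are $C^\infty$ diffeomorphisms $\Xi_1:B^1\to\mathbb R\times\tilde B^0$ and $\Xi_0:B^0\to\mathbb R\times\tilde B^0$ such that $(\Xi_0\circ F\circ\Xi_1^{-1})(x,\tilde v)=(x^2,\tilde v)$ for all $(x,\tilde v)\in\mathbb R\times\tilde B^0$. -/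

import Mathlib

open MeasureTheory Set Filter
open scoped ContDiff

noncomputable section

namespace PeriodicODE

/-! ### Morin singularities and global folds of maps between normed spaces -/

/-- `z` is a Morin singularity of order `k ≥ 1` of `G : E → F`: after smooth local changes of
variables `e₁` near `z` and `e₀` near `G z`, the map takes the adapted form
`(x, y) ↦ (x, μ (x, y))` on an open subset of `X × ℝ`, with `X` a Banach space, and at the point
`(x₀, y₀)` corresponding to `z` one has
(a) `∂μ/∂y = ⋯ = ∂ᵏμ/∂yᵏ = 0`,
(b) `∂ᵏ⁺¹μ/∂yᵏ⁺¹ ≠ 0`,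
(c) the derivative of `(∂μ/∂y, …, ∂ᵏ⁻¹μ/∂yᵏ⁻¹) : X × ℝ → ℝᵏ⁻¹` is surjective. -/
def IsMorinSingularity {E F : Type} [NormedAddCommGroup E] [NormedSpace ℝ E]
    [NormedAddCommGroup F] [NormedSpace ℝ F] (k : ℕ) (G : E → F) (z : E) : Prop :=
  ∃ (X : Type) (_ : NormedAddCommGroup X) (_ : NormedSpace ℝ X) (_ : CompleteSpace X)
    (e₁ : OpenPartialHomeomorph E (X × ℝ)) (e₀ : OpenPartialHomeomorph F (X × ℝ))
    (μ : X × ℝ → ℝ),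
    (z ∈ e₁.source ∧ ContDiffOn ℝ ∞ e₁ e₁.source ∧ ContDiffOn ℝ ∞ e₁.symm e₁.target) ∧
    (G z ∈ e₀.source ∧ ContDiffOn ℝ ∞ e₀ e₀.source ∧ ContDiffOn ℝ ∞ e₀.symm e₀.target) ∧
    MapsTo G e₁.source e₀.source ∧
    ContDiffOn ℝ ∞ μ e₁.target ∧
    (∀ p ∈ e₁.target, e₀ (G (e₁.symm p)) = (p.1, μ p)) ∧
    (∀ i : ℕ, 1 ≤ i → i ≤ k → iteratedDeriv i (fun y => μ ((e₁ z).1, y)) (e₁ z).2 = 0) ∧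
    iteratedDeriv (k + 1) (fun y => μ ((e₁ z).1, y)) (e₁ z).2 ≠ 0 ∧
    Function.Surjective
      (fderiv ℝ (fun (p : X × ℝ) (i : Fin (k - 1)) =>
        iteratedDeriv (i.val + 1) (fun y => μ (p.1, y)) p.2) (e₁ z))

/-- A cusp is a Morin singularity of order two. -/
def IsCusp {E F : Type} [NormedAddCommGroup E] [NormedSpace ℝ E]
    [NormedAddCommGroup F] [NormedSpace ℝ F] (G : E → F) (z : E) : Prop :=
  IsMorinSingularity 2 G z

/-- `G : E → F` is a (differentiable) global fold, relative to a subspace `T` of `F`: there are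
global smooth diffeomorphisms `Ξ₁ : E → ℝ × T` and `Ξ₀ : F → ℝ × T` for which
`Ξ₀ ∘ G ∘ Ξ₁⁻¹` is `(x, v) ↦ (x ^ 2, v)`. -/
def IsGlobalFold {E F : Type} [NormedAddCommGroup E] [NormedSpace ℝ E]
    [NormedAddCommGroup F] [NormedSpace ℝ F] (T : Submodule ℝ F) (G : E → F) : Prop :=
  ∃ (Ξ₁ : E ≃ ℝ × T) (Ξ₀ : F ≃ ℝ × T),
    ContDiff ℝ ∞ Ξ₁ ∧ ContDiff ℝ ∞ Ξ₁.symm ∧ ContDiff ℝ ∞ Ξ₀ ∧ ContDiff ℝ ∞ Ξ₀.symm ∧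
    ∀ (x : ℝ) (v : T), Ξ₀ (G (Ξ₁.symm (x, v))) = (x ^ 2, v)

/-! ### The nonlinearity -/

/-- The curve `x ↦ (f'(x), …, f⁽ᵏ⁾(x))` in `ℝᵏ`. -/
def gammaHat (k : ℕ) (f : ℝ → ℝ) (x : ℝ) : Fin k → ℝ :=
  fun i => iteratedDeriv (i.val + 1) f x

/-- `f` is `k`-good: the curve `gammaHat k f` never vanishes, and it maps no (non-empty) open
interval into a hyperplane through the origin. -/
def IsGood (k : ℕ) (f : ℝ → ℝ) : Prop :=
  (∀ x, gammaHat k f x ≠ 0) ∧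
  ∀ a b : ℝ, a < b → ∀ P : Submodule ℝ (Fin k → ℝ), Module.finrank ℝ P + 1 = k →
    ¬ gammaHat k f '' Ioo a b ⊆ (P : Set (Fin k → ℝ))

/-! ### The `C` case: continuously differentiable functions on the circle `ℝ / ℤ` -/

/-- The Banach space of continuous functions on the circle (sup norm). -/
abbrev C0 : Type := C(UnitAddCircle, ℝ)

/-- The space of continuously differentiable functions on the circle, each stored as the pair
`(u, u')`; the norm is `max (‖u‖_∞) (‖u'‖_∞)`. -/
def C1 : Submodule ℝ (C0 × C0) where
  carrier := {p | ∀ t : ℝ, HasDerivAt (fun s : ℝ => p.1 (s : UnitAddCircle)) (p.2 t) t}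
  add_mem' := fun ha hb t => (ha t).add (hb t)
  zero_mem' := fun t => hasDerivAt_const t (0 : ℝ)
  smul_mem' := fun c _ ha t => (ha t).const_mul c

/-- The operator `u ↦ u' + f ∘ u` from `C¹` to `C⁰`. -/
def opC (f : C(ℝ, ℝ)) (u : C1) : C0 := u.1.2 + f.comp u.1.1

/-- The continuous functions of average zero. -/
def C0tilde : Submodule ℝ C0 where
  carrier := {v | ∫ t, v t = 0}
  add_mem' := by
    intro v w hv hw
    have hi : ∀ v : C0, Integrable (fun t => v t) := fun v =>
      v.continuous.integrable_of_hasCompactSupport (HasCompactSupport.of_compactSpace _)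
    simp only [mem_ofPred_eq, ContinuousMap.add_apply] at *
    rw [integral_add (hi v) (hi w), hv, hw, add_zero]
  zero_mem' := by simp
  smul_mem' := by
    intro c v hv
    simp only [mem_ofPred_eq, ContinuousMap.smul_apply, smul_eq_mul] at *
    rw [integral_const_mul, hv, mul_zero]

/-! ### The `H` case: the Sobolev space `H¹` of the circle -/

/-- The space `L²` of the circle. -/
abbrev H0 : Type := Lp ℝ 2 (volume : Measure UnitAddCircle)

lemma H0.integrable (g : H0) : Integrable (fun t => g t) :=
  (Lp.memLp g).integrable (by norm_num)

lemma H0.intervalIntegrable (g : H0) {t : ℝ} (ht : t ∈ Icc (0 : ℝ) 1) :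
    IntervalIntegrable (fun s : ℝ => g (s : UnitAddCircle)) volume 0 t := by
  have h := (UnitAddCircle.measurePreserving_mk 0).integrable_comp_of_integrable
    (H0.integrable g)
  rw [intervalIntegrable_iff_integrableOn_Ioc_of_le ht.1]
  refine IntegrableOn.mono_set (t := Ioc (0 : ℝ) (0 + 1)) h ?_
  exact Ioc_subset_Ioc_right (by linarith [ht.2])

lemma H0.integral_congr {g h : UnitAddCircle → ℝ} (hgh : g =ᵐ[volume] h) {t : ℝ}
    (ht : t ∈ Icc (0 : ℝ) 1) :
    ∫ s in (0 : ℝ)..t, g (s : UnitAddCircle) = ∫ s in (0 : ℝ)..t, h (s : UnitAddCircle) := by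
  have h1 := (UnitAddCircle.measurePreserving_mk 0).quasiMeasurePreserving.ae_eq_comp hgh
  rw [intervalIntegral.integral_of_le ht.1, intervalIntegral.integral_of_le ht.1]
  refine MeasureTheory.integral_congr_ae ?_
  refine ae_restrict_of_ae_restrict_of_subset (t := Ioc (0 : ℝ) (0 + 1)) ?_ h1
  exact Ioc_subset_Ioc_right (by linarith [ht.2])

/-- The pairs `(u, u')` with `u` an absolutely continuous function on the circle and `u'` its
almost everywhere derivative, assumed to be in `L²`; absolute continuity is expressed by
`u(t) = u(0) + ∫₀ᵗ u'` for `0 ≤ t ≤ 1`. -/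
def H1pairs : Submodule ℝ (C0 × H0) where
  carrier := {p | ∀ t ∈ Icc (0 : ℝ) 1,
    p.1 (t : UnitAddCircle) = p.1 ((0 : ℝ) : UnitAddCircle)
      + ∫ s in (0 : ℝ)..t, p.2 (s : UnitAddCircle)}
  add_mem' := by
    intro p q hp hq t ht
    have h := H0.integral_congr (Lp.coeFn_add p.2 q.2) ht
    simp only [Pi.add_apply] at h
    rw [intervalIntegral.integral_add (H0.intervalIntegrable _ ht)
      (H0.intervalIntegrable _ ht)] at h
    simp only [Prod.fst_add, Prod.snd_add, ContinuousMap.add_apply]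
    rw [h, hp t ht, hq t ht]
    ring
  zero_mem' := by
    intro t ht
    have h := H0.integral_congr (Lp.coeFn_zero ℝ 2 (volume : Measure UnitAddCircle)) ht
    simp only [Prod.fst_zero, Prod.snd_zero, ContinuousMap.zero_apply]
    rw [h]
    simp
  smul_mem' := by
    intro c p hp t ht
    have h := H0.integral_congr (Lp.coeFn_smul c p.2) ht
    simp only [Pi.smul_apply, smul_eq_mul] at h
    rw [intervalIntegral.integral_const_mul] at h
    simp only [Prod.smul_fst, Prod.smul_snd, ContinuousMap.smul_apply, smul_eq_mul]
    rw [h, hp t ht]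
    ring

/-- The Sobolev space `H¹` of the circle; its norm is introduced below. -/
def H1 : Type := H1pairs

instance : AddCommGroup H1 := inferInstanceAs (AddCommGroup H1pairs)

instance : Module ℝ H1 := inferInstanceAs (Module ℝ H1pairs)

/-- The function underlying an element of `H¹`. -/
def H1.fn (u : H1) : C0 := u.1.1

/-- The derivative of an element of `H¹`. -/
def H1.der (u : H1) : H0 := u.1.2

/-- The inclusion `C⁰ → L²`. -/
def toH0 : C0 →ₗ[ℝ] H0 :=
  (ContinuousMap.toLp (E := ℝ) 2 (volume : Measure UnitAddCircle) ℝ).toLinearMap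

/-- The map `u ↦ (u, u')` from `H¹` to the Hilbert sum `L² ⊕ L²`. -/
def H1.toL2 : H1 →ₗ[ℝ] WithLp 2 (H0 × H0) where
  toFun u := WithLp.toLp 2 (toH0 u.fn, u.der)
  map_add' u v := by
    have h1 : (u + v).fn = u.fn + v.fn := rfl
    have h2 : (u + v).der = u.der + v.der := rfl
    rw [h1, h2, map_add]
    rfl
  map_smul' c u := by
    have h1 : (c • u).fn = c • u.fn := rfl
    have h2 : (c • u).der = c • u.der := rfl
    rw [h1, h2, map_smul]
    rfl

lemma H1.toL2_injective : Function.Injective H1.toL2 := by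
  intro u v h
  have h' : (toH0 u.fn, u.der) = (toH0 v.fn, v.der) := congrArg WithLp.ofLp h
  have h1 : u.fn = v.fn :=
    ContinuousMap.toLp_injective (E := ℝ) (p := 2) (𝕜 := ℝ)
      (volume : Measure UnitAddCircle) ((Prod.ext_iff.mp h').1)
  have h2 : u.der = v.der := (Prod.ext_iff.mp h').2
  exact Subtype.ext (Prod.ext h1 h2)

/-- The Hilbert norm `‖u‖² = ‖u‖²_{L²} + ‖u'‖²_{L²}` on `H¹`. -/
instance : NormedAddCommGroup H1 :=
  NormedAddCommGroup.induced H1 (WithLp 2 (H0 × H0)) H1.toL2 H1.toL2_injective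

instance : NormedSpace ℝ H1 := NormedSpace.induced ℝ H1 (WithLp 2 (H0 × H0)) H1.toL2

/-- The operator `u ↦ u' + f ∘ u` from `H¹` to `L²`. -/
def opH (f : C(ℝ, ℝ)) (u : H1) : H0 := u.der + toH0 (f.comp u.fn)

/-- The elements of `L²` of average zero. -/
def H0tilde : Submodule ℝ H0 where
  carrier := {v | ∫ t, v t = 0}
  add_mem' := by
    intro v w hv hw
    simp only [mem_ofPred_eq] at *
    rw [integral_congr_ae (Lp.coeFn_add v w)]
    simp only [Pi.add_apply]
    rw [integral_add (H0.integrable v) (H0.integrable w), hv, hw, add_zero]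
  zero_mem' := by
    simp only [mem_ofPred_eq]
    rw [integral_congr_ae (Lp.coeFn_zero ℝ 2 (volume : Measure UnitAddCircle))]
    simp
  smul_mem' := by
    intro c v hv
    simp only [mem_ofPred_eq] at *
    rw [integral_congr_ae (Lp.coeFn_smul c v)]
    simp only [Pi.smul_apply, smul_eq_mul]
    rw [integral_const_mul, hv, mul_zero]

end PeriodicODE

end

/-! Let `y = u(0)` and let `v` be the projection of `u' + f ∘ u` onto the elements of average zero.
Integration shows that `u` solves `u + prim (f ∘ u) = y + primitive v` in `C⁰`, where `prim`
integrates a function minus its average. The map `addPrim f : u ↦ u + prim (f ∘ u)` is a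
diffeomorphism of `C⁰` (`exists_solution`): an integrating factor inverts its linearizations, and
the growth of `f` gives a priori bounds. Hence `(y, v)` are global coordinates on `B¹`, in which the
operator becomes `(y, v) ↦ (h(y, v), v)` with `h` the average of `f ∘ u` (`CircleModel.split_op`).
What remains is a family of functions of one real variable, each tending to `+∞` at both ends
(`tendsto_mean_comp`).

Put `w = ∂u/∂y` and `E = exp ∫ f'(u)`. Then `∂h · ∫E = exp (mean f'(u)) - 1`, so criticality means
that `f'(u)` has average zero, and there `w = 1/E > 0`. At such a point `∂²h · ∫E = mean (f''(u)
w)`, and if this vanishes too, `∂³h · ∫E = mean (f'''(u) w²)` (`deriv_mean_mul`,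
`deriv_mean_two_mul`, `deriv_mean_three_mul`).

If the origin is not interior to the hull, a supporting functional gives `a f' + b f'' ≥ 0`, and the
growth of `f` forces `b > 0`. Since `mean (f'(u) w) = 0` at a critical point, goodness yields `mean
(f''(u) w) > 0`. All critical points on vertical lines are then nondegenerate minima, and a global
Morse lemma with parameters (`exists_fold_normal_form`) produces the fold.

If the origin is interior, choose an oscillation `U` so large that every nontrivial combination of
`f'(U)`, `f''(U)` takes positive values. By Hahn–Banach and 3-goodness there is a positive density
`ρ` orthogonal to both of them but not to `f'''(U)` (`exists_density`). A change of time turns `w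
dt` into a multiple of `ρ ds`: solve `W' = -f'(U) ρ` and let `dt = (ρ / W) ds`. The free constant in
`W` is tuned so that a whole number of turns of `U` takes unit time and the third derivative does
not vanish (`exists_cusp_data`). The transversality condition holds because, when `u` moves in the
direction `f''(u)`, the derivative of `∂h` is `mean (f''(u)²)` up to a positive factor. -/

namespace PeriodicODE

open scoped Topology

/-! ### Superposition operators are smooth -/

section Superposition

variable {K : Type} [TopologicalSpace K] [CompactSpace K]
variable {X Y : Type} [NormedAddCommGroup X] [NormedSpace ℝ X]
  [NormedAddCommGroup Y] [NormedSpace ℝ Y]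

/-- Pointwise application of a family of operators to a family of vectors. -/
noncomputable def pointwiseApply : C(K, X →L[ℝ] Y) →L[ℝ] C(K, X) →L[ℝ] C(K, Y) :=
  LinearMap.mkContinuous₂
    (LinearMap.mk₂ ℝ (fun (A : C(K, X →L[ℝ] Y)) (u : C(K, X)) =>
        (⟨fun s => A s (u s), A.continuous.clm_apply u.continuous⟩ : C(K, Y)))
      (fun _ _ _ => by ext; simp) (fun _ _ _ => by ext; simp)
      (fun _ _ _ => by ext; simp) (fun _ _ _ => by ext; simp)) 1 (by
      intro A u
      rw [one_mul, ContinuousMap.norm_le _ (by positivity)]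
      intro s
      exact ((A s).le_opNorm _).trans
        (mul_le_mul (A.norm_coe_le_norm s) (u.norm_coe_le_norm s) (norm_nonneg _) (norm_nonneg A)))

/-- The mean value inequality gives the remainder estimate pointwise. The radius on which `φ'`
varies by less than `ε` has to be uniform over `K`; it comes from continuity of post-composition
with `φ'`, tested on shifts of `u` by constant functions. -/
lemma hasFDerivAt_superposition {φ : X → Y} {φ' : X → X →L[ℝ] Y} (hφ : Continuous φ)
    (hd : ∀ x, HasFDerivAt φ (φ' x) x) (hφ' : Continuous φ') (u : C(K, X)) :
    HasFDerivAt (fun v : C(K, X) => (⟨φ, hφ⟩ : C(X, Y)).comp v)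
      (pointwiseApply ((⟨φ', hφ'⟩ : C(X, X →L[ℝ] Y)).comp u)) u := by
  rw [hasFDerivAt_iff_isLittleO_nhds_zero, Asymptotics.isLittleO_iff]
  intro ε hε
  have hc : Continuous fun x : X =>
      (⟨φ', hφ'⟩ : C(X, X →L[ℝ] Y)).comp (u + ContinuousMap.const K x) :=
    (ContinuousMap.continuous_postcomp _).comp
      (continuous_const.add ContinuousMap.continuous_const')
  have hU : Metric.ball ((⟨φ', hφ'⟩ : C(X, X →L[ℝ] Y)).comp (u + ContinuousMap.const K 0)) ε ∈
      𝓝 ((⟨φ', hφ'⟩ : C(X, X →L[ℝ] Y)).comp (u + ContinuousMap.const K 0)) :=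
    Metric.ball_mem_nhds (α := C(K, X →L[ℝ] Y)) _ hε
  obtain ⟨δ, hδ, hball⟩ := Metric.eventually_nhds_iff.mp ((hc.tendsto 0).eventually_mem hU)
  filter_upwards [Metric.ball_mem_nhds (0 : C(K, X)) hδ] with w hw
  rw [mem_ball_zero_iff] at hw
  rw [ContinuousMap.norm_le _ (by positivity)]
  intro s
  have hws : ‖w s‖ < δ := (w.norm_coe_le_norm s).trans_lt hw
  have key : ‖φ (u s + w s) - φ (u s) - φ' (u s) (u s + w s - u s)‖ ≤
      ε * ‖u s + w s - u s‖ := by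
    refine (convex_ball (u s) δ).norm_image_sub_le_of_norm_hasFDerivWithin_le' (f := φ) (f' := φ')
      (fun x _ => (hd x).hasFDerivWithinAt) ?_ (Metric.mem_ball_self hδ) (by simpa using hws)
    intro x hx
    have h1 := hball (y := x - u s) (by simpa [dist_eq_norm] using hx)
    have h2 := (ContinuousMap.dist_apply_le_dist s).trans (Metric.mem_ball.mp h1).le
    simpa [dist_eq_norm] using h2
  rw [add_sub_cancel_left] at key
  refine key.trans ?_
  gcongr
  exact w.norm_coe_le_norm s

/-- Induction on the order: the derivative is `pointwiseApply` of the superposition operator of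
`fderiv ℝ φ`, so the target `Y` has to vary. -/
lemma contDiff_superposition {φ : X → Y} (hφ : ContDiff ℝ ∞ φ) :
    ContDiff ℝ ∞ (fun v : C(K, X) => (⟨φ, hφ.continuous⟩ : C(X, Y)).comp v) := by
  rw [contDiff_infty]
  intro n
  induction n generalizing Y with
  | zero => exact contDiff_zero.mpr (ContinuousMap.continuous_postcomp _)
  | succ n ih =>
    have h1 := contDiff_infty_iff_fderiv.mp hφ
    have h2 := contDiff_succ_iff_hasFDerivAt (𝕜 := ℝ) (n := n)
      (f := fun v : C(K, X) => (⟨φ, hφ.continuous⟩ : C(X, Y)).comp v)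
    refine h2.mpr ⟨_, ?_, hasFDerivAt_superposition hφ.continuous
      (fun x => (h1.1 x).hasFDerivAt) h1.2.continuous⟩
    exact pointwiseApply.contDiff.comp (ih h1.2)

end Superposition

/-! ### Global inverses -/

/-- The inverse function theorem makes `Φ` open, hence a homeomorphism; smoothness of the inverse is
then local. -/
lemma contDiff_symm_of_hasFDerivAt {E F : Type} [NormedAddCommGroup E] [NormedSpace ℝ E]
    [CompleteSpace E] [NormedAddCommGroup F] [NormedSpace ℝ F] (Φ : E ≃ F)
    (hΦ : ContDiff ℝ ∞ Φ) (hd : ∀ x, ∃ A : E ≃L[ℝ] F, HasFDerivAt Φ (A : E →L[ℝ] F) x) :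
    ContDiff ℝ ∞ Φ.symm := by
  choose A hA using hd
  have ho : IsOpenMap Φ := isOpenMap_of_hasStrictFDerivAt_equiv (f' := A) fun x =>
    hΦ.contDiffAt.hasStrictFDerivAt' (hA x) (by simp)
  exact (Φ.toHomeomorphOfContinuousOpen hΦ.continuous ho).contDiff_symm hA hΦ

/-! ### Functions whose zeros are all strictly increasing -/

/-- A zero can only be crossed upwards, so `p` stays nonnegative after `a`; a zero at `b` would
force negative values just to its left. -/
lemma pos_of_deriv_pos_at_zeros {p p' : ℝ → ℝ} (hp : ∀ t, HasDerivAt p (p' t) t)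
    (hz : ∀ t, p t = 0 → 0 < p' t) {a b : ℝ} (ha : 0 ≤ p a) (hab : a < b) : 0 < p b := by
  have hnn : ∀ t ∈ Icc a b, 0 ≤ p t := by
    intro t ht
    have := image_le_of_deriv_right_lt_deriv_boundary (f := fun t => -p t) (f' := fun t => -p' t)
      (a := a) (b := b) (B := fun _ => 0) (B' := fun _ => 0)
      (fun t _ => (hp t).neg.continuousAt.continuousWithinAt)
      (fun t _ => (hp t).neg.hasDerivWithinAt) (by simpa using ha)
      (fun t => hasDerivAt_const t 0)
      (fun t _ h0 => by have := hz t (by simpa using h0); simpa using this) ht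
    simpa using this
  refine (hnn b ⟨hab.le, le_rfl⟩).lt_of_ne fun h0 => ?_
  have hd := hz b h0.symm
  have h1 : ∀ᶠ t in 𝓝[<] b, p t < 0 := by
    have := (hasDerivAt_iff_tendsto_slope_left_right.mp (hp b)).1
    filter_upwards [this.eventually (lt_mem_nhds hd), self_mem_nhdsWithin] with t ht htb
    rw [slope_def_field, ← h0, sub_zero] at ht
    have h2 : t - b < 0 := sub_neg.mpr htb
    exact (div_pos_iff.mp ht).elim (fun h => absurd h.2 h2.le.not_gt) fun h => h.1
  obtain ⟨t, ht, ht'⟩ := (h1.and (Ioo_mem_nhdsLT hab)).exists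
  exact absurd (hnn t ⟨ht'.1.le, ht'.2.le⟩) (not_le.mpr ht)

lemma neg_of_deriv_pos_at_zeros {p p' : ℝ → ℝ} (hp : ∀ t, HasDerivAt p (p' t) t)
    (hz : ∀ t, p t = 0 → 0 < p' t) {a b : ℝ} (hb : p b ≤ 0) (hab : a < b) : p a < 0 := by
  have := pos_of_deriv_pos_at_zeros (p := fun t => -p (-t)) (p' := fun t => p' (-t))
    (fun t => by simpa [Function.comp_def] using ((hp (-t)).scomp t (hasDerivAt_neg t)).fun_neg)
    (fun t h => hz _ (by simpa using h)) (a := -b) (b := -a) (by simpa using hb) (by linarith)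
  simpa using this

/-! ### The normal form of a family of functions of one variable with nondegenerate minima -/

section FoldNormalForm

variable {T : Type} [NormedAddCommGroup T] [NormedSpace ℝ T]

/-- The partial derivative in the real variable. -/
noncomputable def partialFst (h : ℝ × T → ℝ) (p : ℝ × T) : ℝ := fderiv ℝ h p (1, 0)

lemma contDiff_partialFst {h : ℝ × T → ℝ} (hh : ContDiff ℝ ∞ h) :
    ContDiff ℝ ∞ (partialFst h) :=
  (contDiff_infty_iff_fderiv.mp hh).2.clm_apply contDiff_const

lemma hasDerivAt_partialFst {h : ℝ × T → ℝ} (hh : ContDiff ℝ ∞ h) (y : ℝ) (v : T) :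
    HasDerivAt (fun y => h (y, v)) (partialFst h (y, v)) y := by
  have h1 : HasDerivAt (fun y : ℝ => (y, v)) ((1 : ℝ), (0 : T)) y :=
    (hasDerivAt_id y).prodMk (hasDerivAt_const y v)
  exact ((hh.differentiable (by simp)) (y, v)).hasFDerivAt.comp_hasDerivAt y h1

/-- The linear automorphism `(a, b) ↦ (D (a, b), b)`. -/
noncomputable def shearEquiv (D : ℝ × T →L[ℝ] ℝ) (hD : D (1, 0) ≠ 0) : (ℝ × T) ≃L[ℝ] ℝ × T :=
  ContinuousLinearEquiv.equivOfInverse (D.prod (ContinuousLinearMap.snd ℝ ℝ T))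
    (((D (1, 0))⁻¹ • (ContinuousLinearMap.fst ℝ ℝ T -
      D.comp ((ContinuousLinearMap.inr ℝ ℝ T).comp (ContinuousLinearMap.snd ℝ ℝ T)))).prod
      (ContinuousLinearMap.snd ℝ ℝ T))
    (by
      rintro ⟨a, b⟩
      have : D (a, b) = a * D (1, 0) + D (0, b) := by
        rw [← smul_eq_mul, ← map_smul, ← map_add]; simp
      simp only [ContinuousLinearMap.prod_apply, ContinuousLinearMap.coe_snd',
        FunLike.coe_smul, Pi.smul_apply, FunLike.coe_sub, Pi.sub_apply,
        ContinuousLinearMap.coe_fst', ContinuousLinearMap.comp_apply,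
        ContinuousLinearMap.inr_apply, smul_eq_mul, this]
      ext
      · field_simp; ring
      · rfl)
    (by
      rintro ⟨a, b⟩
      have : ∀ c, D (c, b) = c * D (1, 0) + D (0, b) := fun c => by
        rw [← smul_eq_mul, ← map_smul, ← map_add]; simp
      simp only [ContinuousLinearMap.prod_apply, ContinuousLinearMap.coe_snd',
        FunLike.coe_smul, Pi.smul_apply, FunLike.coe_sub, Pi.sub_apply,
        ContinuousLinearMap.coe_fst', ContinuousLinearMap.comp_apply,
        ContinuousLinearMap.inr_apply, smul_eq_mul]
      rw [this]
      ext
      · field_simp; ring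
      · rfl)

lemma hasFDerivAt_shear {h : ℝ × T → ℝ} (hh : ContDiff ℝ ∞ h) (p : ℝ × T)
    (hp : partialFst h p ≠ 0) :
    HasFDerivAt (fun p : ℝ × T => (h p, p.2))
      (shearEquiv (fderiv ℝ h p) hp : ℝ × T →L[ℝ] ℝ × T) p :=
  ((hh.differentiable (by simp)) p).hasFDerivAt.prodMk hasFDerivAt_snd

/-- The segment from `(0, v)` to `(y, v)` as a continuous function on the unit interval. -/
noncomputable def horizontalSegment : ℝ × T →L[ℝ] C(unitInterval, ℝ × T) :=
  LinearMap.mkContinuous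
    { toFun := fun p => ⟨fun s => ((s : ℝ) * p.1, p.2), by fun_prop⟩
      map_add' := fun p q => by ext s <;> simp [mul_add]
      map_smul' := fun c p => by ext s <;> simp [mul_left_comm] } 1 (by
    intro p
    rw [one_mul, ContinuousMap.norm_le _ (norm_nonneg _)]
    intro s
    refine max_le ?_ (norm_snd_le p)
    refine le_trans ?_ (norm_fst_le p)
    simp only [LinearMap.coe_mk, AddHom.coe_mk, ContinuousMap.coe_mk, norm_mul]
    refine mul_le_of_le_one_left (norm_nonneg _) ?_
    rw [Real.norm_of_nonneg s.2.1]
    exact s.2.2)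

/-- Integration over the unit interval. -/
noncomputable def unitIntegral : C(unitInterval, ℝ) →L[ℝ] ℝ :=
  LinearMap.mkContinuous
    { toFun := fun u => ∫ s in (0 : ℝ)..1, u (projIcc 0 1 zero_le_one s)
      map_add' := fun u v => by
        simp only [ContinuousMap.add_apply]
        exact intervalIntegral.integral_add
          ((u.continuous.comp continuous_projIcc).intervalIntegrable _ _)
          ((v.continuous.comp continuous_projIcc).intervalIntegrable _ _)
      map_smul' := fun c u => by simp } 1 (by
    intro u
    have := intervalIntegral.norm_integral_le_of_norm_le_const (a := (0 : ℝ)) (b := 1)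
      (f := fun s => u (projIcc 0 1 zero_le_one s)) (C := ‖u‖) fun s _ => u.norm_coe_le_norm _
    simpa using this)

/-- Hadamard's lemma with parameters. -/
lemma exists_eq_mul_of_eq_zero {h : ℝ × T → ℝ} (hh : ContDiff ℝ ∞ h) (h0 : ∀ v, h (0, v) = 0) :
    ∃ g : ℝ × T → ℝ, ContDiff ℝ ∞ g ∧ (∀ y v, h (y, v) = y * g (y, v)) ∧
      ∀ v, g (0, v) = partialFst h (0, v) := by
  have hd := contDiff_partialFst hh
  -- `g (y, v) = ∫₀¹ ∂h (s y, v) ds`. Written through a superposition operator on functions on `[0,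
  -- 1]`, it is smooth in `(y, v)` without differentiating under the integral.
  refine ⟨fun p => unitIntegral
    ((⟨partialFst h, hd.continuous⟩ : C(ℝ × T, ℝ)).comp (horizontalSegment p)),
    unitIntegral.contDiff.comp ((contDiff_superposition hd).comp
      (horizontalSegment (T := T)).contDiff),
    ?_, ?_⟩
  · intro y v
    have h1 : ∀ s ∈ uIcc (0 : ℝ) 1,
        HasDerivAt (fun s => h (s * y, v)) (y * partialFst h (s * y, v)) s := by
      intro s _
      have := (hasDerivAt_partialFst hh (s * y) v).comp s ((hasDerivAt_id s).mul_const y)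
      simpa [Function.comp_def, mul_comm] using this
    have h2 := intervalIntegral.integral_eq_sub_of_hasDerivAt h1
      (Continuous.intervalIntegrable (continuous_const.mul
        (hd.continuous.comp (by fun_prop))) _ _)
    rw [one_mul, zero_mul, h0, sub_zero, intervalIntegral.integral_const_mul] at h2
    rw [← h2]
    congr 1
    refine intervalIntegral.integral_congr fun s hs => ?_
    rw [uIcc_of_le zero_le_one] at hs
    simp [horizontalSegment, projIcc_of_mem zero_le_one hs]
  · intro v
    simp [unitIntegral, horizontalSegment]

variable [CompleteSpace T]

/-- Implicit function theorem. Since each line carries a single zero, the local smooth solution must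
be `c`, and no prior continuity of `c` is needed. -/
lemma contDiff_of_unique_zero {h : ℝ × T → ℝ} (hh : ContDiff ℝ ∞ h) {c : T → ℝ}
    (hc : ∀ y v, h (y, v) = 0 ↔ y = c v) (hd : ∀ v, partialFst h (c v, v) ≠ 0) :
    ContDiff ℝ ∞ c := by
  rw [contDiff_iff_contDiffAt]
  intro v
  have hΦ : ContDiffAt ℝ ∞ (fun p : ℝ × T => (h p, p.2)) (c v, v) :=
    (hh.prodMk contDiff_snd).contDiffAt
  have hder := hasFDerivAt_shear hh (c v, v) (hd v)
  have hs := hΦ.hasStrictFDerivAt' hder (by simp)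
  have h1 := hΦ.to_localInverse hder (by simp)
  have hv : h (c v, v) = 0 := (hc _ _).mpr rfl
  simp only [hv] at h1
  have h2 : ∀ᶠ w in 𝓝 v, (fun p : ℝ × T => (h p, p.2))
      (hΦ.localInverse hder (by simp) ((0 : ℝ), w)) = (0, w) := by
    have := hs.eventually_right_inverse
    simp only [hv] at this
    exact ((by fun_prop : Continuous fun w : T => ((0 : ℝ), w)).tendsto v).eventually this
  have h3 : ContDiffAt ℝ ∞ (fun w => (hΦ.localInverse hder (by simp) ((0 : ℝ), w)).1) v :=
    contDiffAt_fst.comp v (h1.comp v (contDiff_const.prodMk contDiff_id).contDiffAt)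
  refine h3.congr_of_eventuallyEq ?_
  filter_upwards [h2] with w hw
  refine ((hc _ _).mp ?_).symm
  generalize hΦ.localInverse hder (by simp) ((0 : ℝ), w) = q at hw ⊢
  rw [Prod.mk.injEq] at hw
  rw [← hw.1, ← hw.2]

/-- A smooth family of functions on the line with quadratically degenerate critical point at the
origin, and no other critical points, is the square of a smooth family of diffeomorphisms. -/
lemma exists_equiv_sq {h : ℝ × T → ℝ} (hh : ContDiff ℝ ∞ h) (h0 : ∀ v, h (0, v) = 0)
    (hpos : ∀ y v, y ≠ 0 → 0 < h (y, v)) (hdp : ∀ y v, 0 < y → 0 < partialFst h (y, v))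
    (hdn : ∀ y v, y < 0 → partialFst h (y, v) < 0)
    (hd0 : ∀ v, 0 < partialFst (partialFst h) (0, v))
    (hlim : ∀ v, Tendsto (fun y => h (y, v)) (cocompact ℝ) atTop) :
    ∃ Θ : ℝ × T ≃ ℝ × T, ContDiff ℝ ∞ Θ ∧ ContDiff ℝ ∞ Θ.symm ∧
      ∀ y v, (Θ (y, v)).1 ^ 2 = h (y, v) ∧ (Θ (y, v)).2 = v := by
  have hz : ∀ v, partialFst h (0, v) = 0 := by
    intro v
    have hmin : IsLocalMin (fun y => h (y, v)) 0 := by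
      refine Eventually.of_forall fun y => ?_
      rcases eq_or_ne y 0 with rfl | hy
      · exact le_rfl
      · exact (h0 v).le.trans (hpos y v hy).le
    exact hmin.hasDerivAt_eq_zero (hasDerivAt_partialFst hh 0 v)
  -- Hadamard's lemma twice gives `h = y² h₂` with `h₂ > 0`; the new variable is `X = y √h₂`.
  obtain ⟨h₁, hh₁, e₁, i₁⟩ := exists_eq_mul_of_eq_zero hh h0
  obtain ⟨h₂, hh₂, e₂, i₂⟩ := exists_eq_mul_of_eq_zero hh₁ fun v => (i₁ v).trans (hz v)
  have hd1 : ∀ y v, partialFst h (y, v) = h₁ (y, v) + y * partialFst h₁ (y, v) := by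
    intro y v
    refine (hasDerivAt_partialFst hh y v).unique ?_
    simp_rw [e₁]
    simpa using (hasDerivAt_id y).fun_mul (hasDerivAt_partialFst hh₁ y v)
  have hd2 : ∀ v, partialFst (partialFst h) (0, v) = 2 * h₂ (0, v) := by
    intro v
    refine (hasDerivAt_partialFst (contDiff_partialFst hh) 0 v).unique ?_
    simp_rw [hd1]
    have := (hasDerivAt_partialFst hh₁ 0 v).fun_add ((hasDerivAt_id (0 : ℝ)).fun_mul
      (hasDerivAt_partialFst (contDiff_partialFst hh₁) 0 v))
    refine this.congr_deriv ?_
    rw [i₂]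
    simp
    ring
  have hh2pos : ∀ p, 0 < h₂ p := by
    rintro ⟨y, v⟩
    rcases eq_or_ne y 0 with rfl | hy
    · have := hd0 v
      rw [hd2] at this
      linarith
    · have := hpos y v hy
      rw [e₁, e₂, ← mul_assoc] at this
      exact pos_of_mul_pos_right this (mul_self_nonneg y)
  have hS : ContDiff ℝ ∞ fun p => Real.sqrt (h₂ p) := hh₂.sqrt fun p => (hh2pos p).ne'
  set X : ℝ × T → ℝ := fun p => p.1 * Real.sqrt (h₂ p) with hXdef
  have hX : ContDiff ℝ ∞ X := contDiff_fst.mul hS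
  have hXsq : ∀ y v, X (y, v) ^ 2 = h (y, v) := by
    intro y v
    rw [e₁, e₂, hXdef]
    simp only
    rw [mul_pow, Real.sq_sqrt (hh2pos _).le]
    ring
  have hXpos : ∀ y v, 0 < y → 0 < X (y, v) := fun y v hy =>
    mul_pos hy (Real.sqrt_pos.mpr (hh2pos _))
  have hXneg : ∀ y v, y < 0 → X (y, v) < 0 := fun y v hy =>
    mul_neg_of_neg_of_pos hy (Real.sqrt_pos.mpr (hh2pos _))
  have hXd : ∀ y v, 2 * X (y, v) * partialFst X (y, v) = partialFst h (y, v) := by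
    intro y v
    have h3 := (hasDerivAt_partialFst hX y v).fun_pow 2
    refine HasDerivAt.unique ?_ (hasDerivAt_partialFst hh y v)
    simp_rw [← hXsq]
    simpa using h3
  have hXd0 : ∀ v, partialFst X (0, v) = Real.sqrt (h₂ (0, v)) := by
    intro v
    refine (hasDerivAt_partialFst hX 0 v).unique ?_
    have := (hasDerivAt_id (0 : ℝ)).fun_mul (hasDerivAt_partialFst hS 0 v)
    simpa using this
  -- Off `y = 0` the sign follows from `2 X ∂X = ∂h`. At `y = 0` this identity is empty, and the
  -- explicit value `√h₂` is used.
  have hXdpos : ∀ p, 0 < partialFst X p := by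
    rintro ⟨y, v⟩
    rcases lt_trichotomy y 0 with hy | rfl | hy
    · have h3 := hdn y v hy
      rw [← hXd] at h3
      have := hXneg y v hy
      by_contra hc
      nlinarith
    · rw [hXd0]
      exact Real.sqrt_pos.mpr (hh2pos _)
    · have h3 := hdp y v hy
      rw [← hXd] at h3
      exact pos_of_mul_pos_right h3 (by have := hXpos y v hy; linarith)
  have hmono : ∀ v, StrictMono fun y => X (y, v) := fun v =>
    strictMono_of_hasDerivAt_pos (fun y => hasDerivAt_partialFst hX y v) fun y => hXdpos _
  have hsurj : ∀ v, Function.Surjective fun y => X (y, v) := by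
    intro v
    have hl := hlim v
    rw [cocompact_eq_atBot_atTop, tendsto_sup] at hl
    refine Continuous.surjective (hX.continuous.comp (by fun_prop)) ?_ ?_
    · refine (Real.tendsto_sqrt_atTop.comp hl.2).congr' ?_
      filter_upwards [eventually_gt_atTop 0] with y hy
      simp only [Function.comp_apply]
      rw [← hXsq, Real.sqrt_sq (hXpos y v hy).le]
    · refine (tendsto_neg_atTop_atBot.comp (Real.tendsto_sqrt_atTop.comp hl.1)).congr' ?_
      filter_upwards [eventually_lt_atBot 0] with y hy
      simp only [Function.comp_apply]
      rw [← hXsq, ← neg_sq, Real.sqrt_sq (by have := hXneg y v hy; linarith), neg_neg]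
  have hbij : Function.Bijective fun p : ℝ × T => (X p, p.2) := by
    refine ⟨?_, ?_⟩
    · rintro ⟨y, v⟩ ⟨y', v'⟩ hE
      rw [Prod.mk.injEq] at hE
      obtain ⟨h3, h4⟩ := hE
      simp only at h4
      subst h4
      rw [(hmono v).injective h3]
    · rintro ⟨x, v⟩
      obtain ⟨y, hy⟩ := hsurj v x
      exact ⟨(y, v), Prod.ext hy rfl⟩
  refine ⟨Equiv.ofBijective _ hbij, hX.prodMk contDiff_snd, ?_, fun y v => ⟨hXsq y v, rfl⟩⟩
  exact contDiff_symm_of_hasFDerivAt (Equiv.ofBijective _ hbij) (hX.prodMk contDiff_snd) fun p =>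
    ⟨_, hasFDerivAt_shear hX p (hXdpos p).ne'⟩

/-- A smooth family of functions on the line, proper and bounded below, all of whose critical
points are nondegenerate minima, is `x ^ 2` plus a function of the parameter. -/
theorem exists_fold_normal_form {l : ℝ × T → ℝ} (hl : ContDiff ℝ ∞ l)
    (hlim : ∀ v, Tendsto (fun y => l (y, v)) (cocompact ℝ) atTop)
    (hcrit : ∀ p, partialFst l p = 0 → 0 < partialFst (partialFst l) p) :
    ∃ (Θ : ℝ × T ≃ ℝ × T) (b : T → ℝ), ContDiff ℝ ∞ Θ ∧ ContDiff ℝ ∞ Θ.symm ∧ ContDiff ℝ ∞ b ∧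
      ∀ p, l p = (Θ p).1 ^ 2 + b p.2 ∧ (Θ p).2 = p.2 := by
  have hl' := contDiff_partialFst hl
  have hex : ∀ v, ∃ y, ∀ y', l (y, v) ≤ l (y', v) := fun v =>
    (hl.continuous.comp (by fun_prop : Continuous fun y : ℝ => (y, v))).exists_forall_le (hlim v)
  choose c hc using hex
  have hmin0 : ∀ y v, (∀ y', l (y, v) ≤ l (y', v)) → partialFst l (y, v) = 0 := fun y v h =>
    IsLocalMin.hasDerivAt_eq_zero (Eventually.of_forall h) (hasDerivAt_partialFst hl y v)
  have hc0 : ∀ v, partialFst l (c v, v) = 0 := fun v => hmin0 _ _ (hc v)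
  -- All zeros of `∂l` on a line are upward crossings, so the minimizer `c v` is the only one.
  have hp : ∀ y v, c v < y → 0 < partialFst l (y, v) := fun y v hy =>
    pos_of_deriv_pos_at_zeros (fun y => hasDerivAt_partialFst hl' y v)
      (fun y => hcrit (y, v)) (hc0 v).ge hy
  have hn : ∀ y v, y < c v → partialFst l (y, v) < 0 := fun y v hy =>
    neg_of_deriv_pos_at_zeros (fun y => hasDerivAt_partialFst hl' y v)
      (fun y => hcrit (y, v)) (hc0 v).le hy
  have huniq : ∀ y v, partialFst l (y, v) = 0 ↔ y = c v := by
    intro y v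
    refine ⟨fun h => ?_, fun h => h ▸ hc0 v⟩
    rcases lt_trichotomy y (c v) with hy | hy | hy
    · exact absurd h (hn y v hy).ne
    · exact hy
    · exact absurd h (hp y v hy).ne'
  have hcs : ContDiff ℝ ∞ c :=
    contDiff_of_unique_zero hl' huniq fun v => (hcrit _ (hc0 v)).ne'
  have hshift : ContDiff ℝ ∞ fun p : ℝ × T => (c p.2 + p.1, p.2) :=
    ((hcs.comp contDiff_snd).add contDiff_fst).prodMk contDiff_snd
  have hbs : ContDiff ℝ ∞ fun v => l (c v, v) := hl.comp (hcs.prodMk contDiff_id)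
  set h : ℝ × T → ℝ := fun p => l (c p.2 + p.1, p.2) - l (c p.2, p.2) with hdef
  have hh : ContDiff ℝ ∞ h := (hl.comp hshift).sub (hbs.comp contDiff_snd)
  have hshiftd : ∀ {k : ℝ × T → ℝ}, ContDiff ℝ ∞ k → ∀ y v,
      HasDerivAt (fun y => k (c v + y, v)) (partialFst k (c v + y, v)) y := fun hk y v =>
    (hasDerivAt_partialFst hk (c v + y) v).comp_const_add (c v) y
  have hhd : ∀ y v, partialFst h (y, v) = partialFst l (c v + y, v) := fun y v =>
    (hasDerivAt_partialFst hh y v).unique ((hshiftd hl y v).sub_const (l (c v, v)))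
  have hhdd : ∀ y v, partialFst (partialFst h) (y, v)
      = partialFst (partialFst l) (c v + y, v) := by
    intro y v
    refine (hasDerivAt_partialFst (contDiff_partialFst hh) y v).unique ?_
    simp_rw [hhd]
    exact hshiftd hl' y v
  obtain ⟨Θ, h1, h2, h3⟩ := exists_equiv_sq hh (fun v => by simp [hdef])
    (fun y v hy => by
      refine sub_pos.mpr ((hc v _).lt_of_ne fun he => hy ?_)
      have := (huniq (c v + y) v).mp (hmin0 _ _ fun y' => he.symm.trans_le (hc v y'))
      linarith)
    (fun y v hy => by rw [hhd]; exact hp _ _ (by linarith))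
    (fun y v hy => by rw [hhd]; exact hn _ _ (by linarith))
    (fun v => by rw [hhdd]; exact hcrit _ (by rw [add_zero]; exact hc0 v))
    (fun v => by
      have hhom := (hlim v).comp (Homeomorph.addLeft (c v)).isClosedEmbedding.tendsto_cocompact
      exact tendsto_atTop_add_const_right _ (-l (c v, v)) hhom)
  have hback : ContDiff ℝ ∞ fun p : ℝ × T => (-c p.2 + p.1, p.2) :=
    ((hcs.comp contDiff_snd).neg.add contDiff_fst).prodMk contDiff_snd
  let e : ℝ × T ≃ ℝ × T :=
    { toFun := fun p => (-c p.2 + p.1, p.2)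
      invFun := fun p => (c p.2 + p.1, p.2)
      left_inv := fun p => by simp
      right_inv := fun p => by simp }
  refine ⟨e.trans Θ, fun v => l (c v, v), h1.comp hback, hshift.comp h2, hbs, ?_⟩
  rintro ⟨y, v⟩
  have h4 := h3 (-c v + y) v
  refine ⟨?_, h4.2⟩
  change l (y, v) = (Θ (-c v + y, v)).1 ^ 2 + l (c v, v)
  rw [h4.1]
  simp [hdef]

end FoldNormalForm

/-! ### Primitives on the circle -/

lemma exists_mem_Ico_coe (x : UnitAddCircle) : ∃ t ∈ Ico (0 : ℝ) 1, (t : UnitAddCircle) = x := by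
  obtain ⟨t, ht, h⟩ := (AddCircle.coe_image_Ico_eq (1 : ℝ) 0).symm ▸ mem_univ x
  exact ⟨t, by simpa using ht, h⟩

lemma coe_one_circle : ((1 : ℝ) : UnitAddCircle) = ((0 : ℝ) : UnitAddCircle) := by
  simp

lemma C0.ext_Icc {u v : C0} (h : ∀ t ∈ Icc (0 : ℝ) 1, u (t : UnitAddCircle) = v t) : u = v := by
  ext x
  obtain ⟨t, ht, rfl⟩ := exists_mem_Ico_coe x
  exact h t (Ico_subset_Icc_self ht)

lemma C0.continuous_coe (u : C0) : Continuous fun t : ℝ => u (t : UnitAddCircle) :=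
  u.continuous.comp (AddCircle.continuous_mk' (1 : ℝ))

lemma C0.intervalIntegrable (u : C0) (a b : ℝ) :
    IntervalIntegrable (fun t : ℝ => u (t : UnitAddCircle)) volume a b :=
  u.continuous_coe.intervalIntegrable a b

/-- The continuous function on the circle that restricts to a given function on `[0, 1]`. -/
noncomputable def liftUnit (F : ℝ → ℝ) (hF : ContinuousOn F (Icc 0 1)) (h01 : F 0 = F 1) : C0 :=
  ⟨AddCircle.liftIco 1 0 F, AddCircle.liftIco_zero_continuous h01 hF⟩

lemma liftUnit_apply {F : ℝ → ℝ} (hF : ContinuousOn F (Icc 0 1)) (h01 : F 0 = F 1) {t : ℝ}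
    (ht : t ∈ Icc (0 : ℝ) 1) : liftUnit F hF h01 (t : UnitAddCircle) = F t := by
  rcases ht.2.lt_or_eq with h | rfl
  · exact AddCircle.liftIco_zero_coe_apply ⟨ht.1, h⟩
  · rw [coe_one_circle, ← h01]
    exact AddCircle.liftIco_zero_coe_apply ⟨le_rfl, zero_lt_one⟩

lemma circle_integral_eq (g : UnitAddCircle → ℝ) :
    ∫ t, g t = ∫ s in (0 : ℝ)..1, g (s : UnitAddCircle) := by
  rw [← UnitAddCircle.intervalIntegral_preimage 0 g, zero_add]

/-- The circle has total mass one, so the `L¹` norm is at most the `L²` norm. -/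
lemma H0.integral_abs_le (g : H0) : ∫ t, |g t| ≤ ‖g‖ := by
  have h1 : ∫ t, |g t| = (eLpNorm g 1 volume).toReal := by
    rw [eLpNorm_one_eq_lintegral_enorm, ← integral_norm_eq_lintegral_enorm (Lp.memLp g).1]
    rfl
  have : IsProbabilityMeasure (volume : Measure UnitAddCircle) := ⟨UnitAddCircle.measure_univ⟩
  rw [h1, Lp.norm_def]
  exact ENNReal.toReal_mono (Lp.memLp g).2.ne
    (eLpNorm_le_eLpNorm_of_exponent_le (by norm_num) (Lp.memLp g).1)

/-- The integral of an `L²` function. -/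
noncomputable def meanH : H0 →L[ℝ] ℝ :=
  LinearMap.mkContinuous
    { toFun := fun g => ∫ t, g t
      map_add' := fun g h => by
        rw [integral_congr_ae (Lp.coeFn_add g h)]
        exact integral_add (H0.integrable g) (H0.integrable h)
      map_smul' := fun c g => by
        rw [integral_congr_ae (Lp.coeFn_smul c g)]
        exact integral_const_mul c _ } 1 (by
    intro g
    rw [one_mul]
    exact (abs_integral_le_integral_abs).trans (H0.integral_abs_le g))

lemma meanH_eq (g : H0) : meanH g = ∫ s in (0 : ℝ)..1, g (s : UnitAddCircle) :=
  circle_integral_eq _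

lemma H0.abs_integral_le (g : H0) {t : ℝ} (ht : t ∈ Icc (0 : ℝ) 1) :
    |∫ s in (0 : ℝ)..t, g (s : UnitAddCircle)| ≤ ‖g‖ := by
  refine (intervalIntegral.abs_integral_le_integral_abs ht.1).trans ?_
  refine le_trans ?_ (H0.integral_abs_le g)
  rw [circle_integral_eq fun t => |g t|]
  exact intervalIntegral.integral_mono_interval le_rfl ht.1 ht.2
    (Eventually.of_forall fun _ => abs_nonneg _)
    (H0.intervalIntegrable g ⟨zero_le_one, le_rfl⟩).abs

lemma H0.continuousOn_primitive (g : H0) :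
    ContinuousOn (fun t : ℝ => ∫ s in (0 : ℝ)..t, g (s : UnitAddCircle)) (Icc 0 1) := by
  have h := intervalIntegral.continuousOn_primitive_interval'
    (H0.intervalIntegrable g ⟨zero_le_one, le_rfl⟩) (left_mem_uIcc)
  rwa [uIcc_of_le zero_le_one] at h

/-- The primitive, vanishing at `0`, of an `L²` function minus its average. -/
noncomputable def primH : H0 →L[ℝ] C0 :=
  LinearMap.mkContinuous
    { toFun := fun g => liftUnit
        (fun t => (∫ s in (0 : ℝ)..t, g (s : UnitAddCircle)) - t * meanH g)
        ((H0.continuousOn_primitive g).sub (by fun_prop)) (by simp [meanH_eq])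
      map_add' := fun g h => C0.ext_Icc fun t ht => by
        have h1 := H0.integral_congr (Lp.coeFn_add g h) ht
        simp only [Pi.add_apply] at h1
        rw [intervalIntegral.integral_add (H0.intervalIntegrable _ ht)
          (H0.intervalIntegrable _ ht)] at h1
        rw [ContinuousMap.add_apply, liftUnit_apply _ _ ht, liftUnit_apply _ _ ht,
          liftUnit_apply _ _ ht, h1, map_add]
        ring
      map_smul' := fun c g => C0.ext_Icc fun t ht => by
        have h1 := H0.integral_congr (Lp.coeFn_smul c g) ht
        simp only [Pi.smul_apply, smul_eq_mul] at h1
        rw [intervalIntegral.integral_const_mul] at h1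
        rw [RingHom.id_apply, ContinuousMap.smul_apply, liftUnit_apply _ _ ht,
          liftUnit_apply _ _ ht, h1, map_smul, smul_eq_mul, smul_eq_mul]
        ring } 2 (by
    intro g
    rw [ContinuousMap.norm_le _ (by positivity)]
    intro x
    obtain ⟨t, ht, rfl⟩ := exists_mem_Ico_coe x
    replace ht := Ico_subset_Icc_self ht
    simp only [LinearMap.coe_mk, AddHom.coe_mk]
    rw [liftUnit_apply _ _ ht, Real.norm_eq_abs]
    have h1 := H0.abs_integral_le g ht
    have h2 := H0.abs_integral_le g (t := 1) ⟨zero_le_one, le_rfl⟩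
    rw [← meanH_eq] at h2
    have h3 : |t * meanH g| ≤ ‖g‖ := by
      rw [abs_mul, abs_of_nonneg ht.1]
      exact (mul_le_of_le_one_left (abs_nonneg _) ht.2).trans h2
    calc _ ≤ _ := abs_sub _ _
      _ ≤ 2 * ‖g‖ := by linarith)

lemma primH_apply (g : H0) {t : ℝ} (ht : t ∈ Icc (0 : ℝ) 1) :
    primH g (t : UnitAddCircle)
      = (∫ s in (0 : ℝ)..t, g (s : UnitAddCircle)) - t * meanH g :=
  liftUnit_apply (F := fun t => (∫ s in (0 : ℝ)..t, g (s : UnitAddCircle)) - t * meanH g)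
    ((H0.continuousOn_primitive g).sub (by fun_prop)) (by simp [meanH_eq]) ht

/-- The inclusion of `C⁰` in `L²` as a continuous linear map. -/
noncomputable def inclH : C0 →L[ℝ] H0 :=
  ContinuousMap.toLp (E := ℝ) 2 (volume : Measure UnitAddCircle) ℝ

lemma coeFn_inclH (u : C0) : (inclH u : UnitAddCircle → ℝ) =ᵐ[volume] u :=
  ContinuousMap.coeFn_toLp (p := 2) (𝕜 := ℝ) (volume : Measure UnitAddCircle) u

/-- The integral of a continuous function on the circle. -/
noncomputable def mean : C0 →L[ℝ] ℝ := meanH.comp inclH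

/-- The primitive, vanishing at `0`, of a continuous function minus its average. -/
noncomputable def prim : C0 →L[ℝ] C0 := primH.comp inclH

lemma mean_eq_integral (u : C0) : mean u = ∫ t, u t := integral_congr_ae (coeFn_inclH u)

lemma mean_eq (u : C0) : mean u = ∫ s in (0 : ℝ)..1, u (s : UnitAddCircle) :=
  (mean_eq_integral u).trans (circle_integral_eq _)

lemma prim_apply (u : C0) {t : ℝ} (ht : t ∈ Icc (0 : ℝ) 1) :
    prim u (t : UnitAddCircle) = (∫ s in (0 : ℝ)..t, u (s : UnitAddCircle)) - t * mean u := by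
  have h := primH_apply (inclH u) ht
  rwa [H0.integral_congr (coeFn_inclH u) ht] at h

lemma prim_zero (u : C0) : prim u ((0 : ℝ) : UnitAddCircle) = 0 := by
  rw [prim_apply u ⟨le_rfl, zero_le_one⟩]; simp

lemma primH_zero (u : H0) : primH u ((0 : ℝ) : UnitAddCircle) = 0 := by
  rw [primH_apply u ⟨le_rfl, zero_le_one⟩]; simp

lemma mean_one : mean 1 = 1 := by
  rw [mean_eq]; simp

lemma prim_one : prim 1 = 0 := C0.ext_Icc fun t ht => by
  rw [prim_apply _ ht, mean_one]; simp

lemma hasDerivAt_integral (u : C0) (t : ℝ) :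
    HasDerivAt (fun t : ℝ => ∫ s in (0 : ℝ)..t, u (s : UnitAddCircle)) (u (t : UnitAddCircle)) t :=
  intervalIntegral.integral_hasDerivAt_right (u.intervalIntegrable _ _)
    u.continuous_coe.stronglyMeasurable.stronglyMeasurableAtFilter u.continuous_coe.continuousAt

/-- Subtracting the average makes the right-hand side periodic, so the formula extends from `[0, 1]`
to the line. -/
lemma prim_apply_real (u : C0) (t : ℝ) :
    prim u (t : UnitAddCircle) = (∫ s in (0 : ℝ)..t, u (s : UnitAddCircle)) - t * mean u := by
  have hper : Function.Periodic
      (fun t : ℝ => (∫ s in (0 : ℝ)..t, u (s : UnitAddCircle)) - t * mean u) 1 := by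
    intro t
    have hp : Function.Periodic (fun s : ℝ => u (s : UnitAddCircle)) 1 := fun s =>
      congrArg u (AddCircle.coe_add_period (1 : ℝ) s)
    have := hp.intervalIntegral_add_eq_add 0 t fun a b => u.intervalIntegrable a b
    simp only [zero_add] at this
    simp only
    rw [this, ← mean_eq]
    ring
  have h2 : ((Int.fract t : ℝ) : UnitAddCircle) = t := by
    conv_rhs => rw [← Int.fract_add_floor t]
    rw [AddCircle.coe_add]
    have : ((⌊t⌋ : ℝ) : UnitAddCircle) = 0 := by
      rw [AddCircle.coe_eq_zero_iff]
      exact ⟨⌊t⌋, by simp⟩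
    rw [this, add_zero]
  have h3 := hper.sub_zsmul_eq ⌊t⌋ (x := t)
  simp only [zsmul_eq_mul, mul_one] at h3
  rw [← h3, ← h2]
  exact prim_apply u ⟨Int.fract_nonneg t, (Int.fract_lt_one t).le⟩

lemma hasDerivAt_prim (u : C0) (t : ℝ) :
    HasDerivAt (fun t : ℝ => prim u (t : UnitAddCircle)) (u (t : UnitAddCircle) - mean u) t := by
  simp_rw [prim_apply_real]
  simpa using (hasDerivAt_integral u t).fun_sub ((hasDerivAt_id t).mul_const (mean u))

/-- A continuously differentiable function on the circle is recovered from its derivative. -/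
lemma eq_const_add_prim {u u' : C0}
    (h : ∀ t : ℝ, HasDerivAt (fun s : ℝ => u (s : UnitAddCircle)) (u' (t : UnitAddCircle)) t) :
    u = ContinuousMap.const _ (u ((0 : ℝ) : UnitAddCircle)) + prim u' ∧ mean u' = 0 := by
  have key : ∀ t : ℝ, ∫ s in (0 : ℝ)..t, u' (s : UnitAddCircle)
      = u (t : UnitAddCircle) - u ((0 : ℝ) : UnitAddCircle) := fun t =>
    intervalIntegral.integral_eq_sub_of_hasDerivAt (fun s _ => h s) (u'.intervalIntegrable _ _)
  have hm : mean u' = 0 := by rw [mean_eq, key, coe_one_circle, sub_self]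
  refine ⟨C0.ext_Icc fun t ht => ?_, hm⟩
  rw [ContinuousMap.add_apply, prim_apply _ ht, key, hm]
  simp

/-! ### The linear equation `x + prim (q * x + r) = c` -/

/-- The integrating factor `exp (∫₀ᵗ q)`. -/
noncomputable def expInt (q : C0) (t : ℝ) : ℝ :=
  Real.exp (∫ s in (0 : ℝ)..t, q (s : UnitAddCircle))

lemma expInt_pos (q : C0) (t : ℝ) : 0 < expInt q t := Real.exp_pos _

lemma expInt_zero (q : C0) : expInt q 0 = 1 := by simp [expInt]

lemma expInt_one (q : C0) : expInt q 1 = Real.exp (mean q) := by rw [expInt, mean_eq]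

lemma hasDerivAt_expInt (q : C0) (t : ℝ) :
    HasDerivAt (expInt q) (q (t : UnitAddCircle) * expInt q t) t := by
  rw [mul_comm]
  exact (hasDerivAt_integral q t).exp

lemma continuous_expInt (q : C0) : Continuous (expInt q) :=
  continuous_iff_continuousAt.mpr fun t => (hasDerivAt_expInt q t).continuousAt

lemma integral_expInt_pos (q : C0) : 0 < ∫ s in (0 : ℝ)..1, expInt q s :=
  intervalIntegral.intervalIntegral_pos_of_pos ((continuous_expInt q).intervalIntegrable _ _)
    (expInt_pos q) zero_lt_one

lemma integral_const_sub_mul_expInt (q r : C0) (κ : ℝ) :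
    ∫ s in (0 : ℝ)..1, (κ - r (s : UnitAddCircle)) * expInt q s
      = κ * (∫ s in (0 : ℝ)..1, expInt q s)
        - ∫ s in (0 : ℝ)..1, r (s : UnitAddCircle) * expInt q s := by
  have h1 : IntervalIntegrable (fun s => κ * expInt q s) volume 0 1 :=
    (continuous_const.mul (continuous_expInt q)).intervalIntegrable _ _
  have h2 : IntervalIntegrable (fun s : ℝ => r (s : UnitAddCircle) * expInt q s) volume 0 1 :=
    (r.continuous_coe.mul (continuous_expInt q)).intervalIntegrable _ _
  simp_rw [sub_mul]
  rw [intervalIntegral.integral_sub h1 h2, intervalIntegral.integral_const_mul]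

lemma C0.abs_le (u : C0) (x : UnitAddCircle) : |u x| ≤ ‖u‖ := u.norm_coe_le_norm x

lemma abs_integral_le_norm (q : C0) {t : ℝ} (ht : t ∈ Icc (0 : ℝ) 1) :
    |∫ s in (0 : ℝ)..t, q (s : UnitAddCircle)| ≤ ‖q‖ := by
  have := intervalIntegral.norm_integral_le_of_norm_le_const (a := (0 : ℝ)) (b := t)
    (f := fun s : ℝ => q (s : UnitAddCircle)) (C := ‖q‖) fun s _ => q.norm_coe_le_norm _
  rw [sub_zero, abs_of_nonneg ht.1, Real.norm_eq_abs] at this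
  exact this.trans (mul_le_of_le_one_right (norm_nonneg _) ht.2)

lemma expInt_le (q : C0) {t : ℝ} (ht : t ∈ Icc (0 : ℝ) 1) : expInt q t ≤ Real.exp ‖q‖ :=
  Real.exp_le_exp.mpr ((le_abs_self _).trans (abs_integral_le_norm q ht))

lemma le_expInt (q : C0) {t : ℝ} (ht : t ∈ Icc (0 : ℝ) 1) : Real.exp (-‖q‖) ≤ expInt q t :=
  Real.exp_le_exp.mpr (neg_le_of_abs_le (abs_integral_le_norm q ht))

/-- Differentiated, the equation is `x' = κ - q x - r` with `x(0) = c`, where `κ` is the average of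
`q x + r`. The formula is variation of constants. -/
lemma mul_expInt_eq {q r x : C0} {c : ℝ}
    (hx : x + prim (q * x + r) = ContinuousMap.const _ c) (t : ℝ) :
    x (t : UnitAddCircle) * expInt q t
      = c + ∫ s in (0 : ℝ)..t, (mean (q * x + r) - r (s : UnitAddCircle)) * expInt q s := by
  set κ := mean (q * x + r) with hκ
  have hX : ∀ t : ℝ, x (t : UnitAddCircle) = c - prim (q * x + r) (t : UnitAddCircle) := fun t => by
    have := congrArg (fun g : C0 => g (t : UnitAddCircle)) hx
    simp only [ContinuousMap.add_apply, ContinuousMap.const_apply] at this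
    linarith
  have hXd : ∀ t : ℝ, HasDerivAt (fun t : ℝ => x (t : UnitAddCircle))
      (κ - q (t : UnitAddCircle) * x (t : UnitAddCircle) - r (t : UnitAddCircle)) t := by
    intro t
    simp_rw [hX]
    refine ((hasDerivAt_prim (q * x + r) t).const_sub c).congr_deriv ?_
    simp only [ContinuousMap.add_apply, ContinuousMap.mul_apply, hX, ← hκ]
    ring
  have h := intervalIntegral.integral_eq_sub_of_hasDerivAt (a := 0) (b := t)
    (f := fun t : ℝ => x (t : UnitAddCircle) * expInt q t)
    (f' := fun s : ℝ => (κ - r (s : UnitAddCircle)) * expInt q s)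
    (fun s _ => ((hXd s).fun_mul (hasDerivAt_expInt q s)).congr_deriv (by ring))
    (((continuous_const.sub r.continuous_coe).mul (continuous_expInt q)).intervalIntegrable _ _)
  rw [h, expInt_zero, hX 0, prim_zero]
  ring

/-- The average `κ` depends on the unknown `x`; periodicity, `x(1) = x(0) = c`, determines it. -/
lemma mean_mul_integral_expInt {q r x : C0} {c : ℝ}
    (hx : x + prim (q * x + r) = ContinuousMap.const _ c) :
    mean (q * x + r) * ∫ s in (0 : ℝ)..1, expInt q s
      = (∫ s in (0 : ℝ)..1, r (s : UnitAddCircle) * expInt q s)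
        + c * (Real.exp (mean q) - 1) := by
  have h := mul_expInt_eq hx 1
  have h0 : x ((1 : ℝ) : UnitAddCircle) = c := by
    have := congrArg (fun g : C0 => g ((0 : ℝ) : UnitAddCircle)) hx
    simp only [ContinuousMap.add_apply, ContinuousMap.const_apply, prim_zero, add_zero] at this
    rw [coe_one_circle, this]
  rw [integral_const_sub_mul_expInt, h0, expInt_one] at h
  linarith

/-- Here `κ` is a weighted mean of `r`, so `|κ| ≤ ‖r‖`, and variation of constants bounds `x`. That
the constant involves `q` only through its norm is what the nonlinear estimate needs. -/
lemma norm_le_of_add_prim_eq_zero {q r x : C0} (hx : x + prim (q * x + r) = 0) :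
    ‖x‖ ≤ 2 * Real.exp ‖q‖ ^ 2 * ‖r‖ := by
  have hx' : x + prim (q * x + r) = ContinuousMap.const _ (0 : ℝ) := hx
  have hI := integral_expInt_pos q
  have hκ : |mean (q * x + r)| ≤ ‖r‖ := by
    have h := mean_mul_integral_expInt hx'
    rw [zero_mul, add_zero] at h
    have h1 : |∫ s in (0 : ℝ)..1, r (s : UnitAddCircle) * expInt q s|
        ≤ ‖r‖ * ∫ s in (0 : ℝ)..1, expInt q s := by
      rw [← intervalIntegral.integral_const_mul]
      have hi : IntervalIntegrable (fun s => ‖r‖ * expInt q s) volume 0 1 :=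
        (continuous_const.mul (continuous_expInt q)).intervalIntegrable _ _
      rw [← Real.norm_eq_abs]
      refine intervalIntegral.norm_integral_le_of_norm_le zero_le_one ?_ hi
      refine Eventually.of_forall fun s _ => ?_
      rw [Real.norm_eq_abs, abs_mul, abs_of_pos (expInt_pos q s)]
      exact mul_le_mul_of_nonneg_right (r.abs_le _) (expInt_pos q s).le
    rw [← h, abs_mul, abs_of_pos hI] at h1
    exact le_of_mul_le_mul_right h1 hI
  rw [ContinuousMap.norm_le _ (by positivity)]
  intro y
  obtain ⟨t, ht, rfl⟩ := exists_mem_Ico_coe y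
  replace ht := Ico_subset_Icc_self ht
  have h := mul_expInt_eq hx' t
  rw [zero_add] at h
  have h2 : |∫ s in (0 : ℝ)..t, (mean (q * x + r) - r (s : UnitAddCircle)) * expInt q s|
      ≤ 2 * ‖r‖ * Real.exp ‖q‖ := by
    have := intervalIntegral.norm_integral_le_of_norm_le_const (a := (0 : ℝ)) (b := t)
      (f := fun s : ℝ => (mean (q * x + r) - r (s : UnitAddCircle)) * expInt q s)
      (C := 2 * ‖r‖ * Real.exp ‖q‖) (fun s hs => by
        rw [uIoc_of_le ht.1] at hs
        rw [Real.norm_eq_abs, abs_mul, abs_of_pos (expInt_pos q s)]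
        refine mul_le_mul ?_ (expInt_le q ⟨hs.1.le, hs.2.trans ht.2⟩) (expInt_pos q s).le
          (by positivity)
        refine (abs_sub _ _).trans ?_
        have := r.abs_le (s : UnitAddCircle)
        linarith)
    rw [sub_zero, abs_of_nonneg ht.1] at this
    exact this.trans (mul_le_of_le_one_right (by positivity) ht.2)
  rw [← h, abs_mul, abs_of_pos (expInt_pos q t)] at h2
  have h3 := mul_le_mul_of_nonneg_left (le_expInt q ht) (abs_nonneg (x (t : UnitAddCircle)))
  have h4 := h3.trans h2
  rw [Real.exp_neg, ← div_eq_mul_inv, div_le_iff₀ (Real.exp_pos _)] at h4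
  calc _ ≤ _ := h4
    _ = _ := by ring

/-- For any `κ` the initial value problem `x' = κ - q x - r`, `x(0) = 0` is solved explicitly. The
weighted mean of `r` is the `κ` for which the solution returns to `0` at time `1`, and it is then
the average of `q x + r`. -/
lemma exists_add_prim_eq_zero (q r : C0) : ∃ x : C0, x + prim (q * x + r) = 0 := by
  have hI := integral_expInt_pos q
  set κ := (∫ s in (0 : ℝ)..1, r (s : UnitAddCircle) * expInt q s)
    / ∫ s in (0 : ℝ)..1, expInt q s with hκ
  set Z : ℝ → ℝ := fun t => (∫ s in (0 : ℝ)..t, (κ - r (s : UnitAddCircle)) * expInt q s)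
    * (expInt q t)⁻¹ with hZ
  have hc : Continuous fun s : ℝ => (κ - r (s : UnitAddCircle)) * expInt q s :=
    (continuous_const.sub r.continuous_coe).mul (continuous_expInt q)
  have hZd : ∀ t : ℝ, HasDerivAt Z
      (κ - r (t : UnitAddCircle) - q (t : UnitAddCircle) * Z t) t := by
    intro t
    have h1 := (hc.integral_hasStrictDerivAt 0 t).hasDerivAt
    refine (h1.fun_mul ((hasDerivAt_expInt q t).fun_inv (expInt_pos q t).ne')).congr_deriv ?_
    have := (expInt_pos q t).ne'
    simp only [hZ]
    field_simp
    ring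
  have hZc : Continuous Z := continuous_iff_continuousAt.mpr fun t => (hZd t).continuousAt
  have hZ0 : Z 0 = 0 := by simp [hZ]
  have hZ1 : Z 1 = 0 := by
    simp only [hZ]
    rw [integral_const_sub_mul_expInt, hκ, div_mul_cancel₀ _ hI.ne', sub_self, zero_mul]
  set x := liftUnit Z hZc.continuousOn (hZ0.trans hZ1.symm) with hx
  have hxZ : ∀ t ∈ Icc (0 : ℝ) 1, x (t : UnitAddCircle) = Z t := fun t ht =>
    liftUnit_apply _ _ ht
  have hint : ∀ t ∈ Icc (0 : ℝ) 1, ∫ s in (0 : ℝ)..t, (q * x + r) (s : UnitAddCircle)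
      = t * κ - Z t := by
    intro t ht
    have h1 := intervalIntegral.integral_eq_sub_of_hasDerivAt (a := 0) (b := t)
      (f := fun t : ℝ => t * κ - Z t)
      (f' := fun s : ℝ => r (s : UnitAddCircle) + q (s : UnitAddCircle) * Z s)
      (fun s _ => (((hasDerivAt_id s).mul_const κ).fun_sub (hZd s)).congr_deriv (by ring))
      ((r.continuous_coe.add (q.continuous_coe.mul hZc)).intervalIntegrable _ _)
    rw [hZ0, zero_mul, sub_zero, sub_zero] at h1
    rw [← h1]
    refine intervalIntegral.integral_congr fun s hs => ?_
    rw [uIcc_of_le ht.1] at hs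
    simp only [ContinuousMap.add_apply, ContinuousMap.mul_apply, hxZ s ⟨hs.1, hs.2.trans ht.2⟩]
    ring
  refine ⟨x, C0.ext_Icc fun t ht => ?_⟩
  rw [ContinuousMap.add_apply, prim_apply _ ht, mean_eq, hint t ht,
    hint 1 ⟨zero_le_one, le_rfl⟩, hZ1, hxZ t ht]
  simp

/-- The operator `x ↦ x + prim (q * x)`. -/
noncomputable def linOp (q : C0) : C0 →L[ℝ] C0 :=
  ContinuousLinearMap.id ℝ C0 + prim.comp (ContinuousLinearMap.mul ℝ C0 q)

lemma linOp_apply (q x : C0) : linOp q x = x + prim (q * x) := rfl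

/-- With `g = linOp q x`, the difference `x - g` solves the equation with right-hand side zero and
`r = q * g`. -/
lemma norm_le_norm_linOp (q x : C0) :
    ‖x‖ ≤ (1 + 2 * Real.exp ‖q‖ ^ 2 * ‖q‖) * ‖linOp q x‖ := by
  set g := linOp q x with hg
  have h : (x - g) + prim (q * (x - g) + q * g) = 0 := by
    rw [← mul_add, sub_add_cancel, hg, linOp_apply]
    abel
  have h1 := norm_le_of_add_prim_eq_zero h
  have h2 : ‖x‖ ≤ ‖x - g‖ + ‖g‖ := by
    simpa using norm_add_le (x - g) g
  have h3 : ‖q * g‖ ≤ ‖q‖ * ‖g‖ := norm_mul_le _ _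
  calc ‖x‖ ≤ 2 * Real.exp ‖q‖ ^ 2 * (‖q‖ * ‖g‖) + ‖g‖ :=
        h2.trans (by gcongr; exact h1.trans (by gcongr))
    _ = _ := by ring

/-- The operator `x ↦ x + prim (q * x)` as an automorphism. -/
noncomputable def linEquiv (q : C0) : C0 ≃L[ℝ] C0 :=
  ContinuousLinearEquiv.ofBijective (linOp q)
    (LinearMap.ker_eq_bot'.mpr fun x hx => by
      have h := norm_le_norm_linOp q x
      rw [show linOp q x = 0 from hx, norm_zero, mul_zero] at h
      exact norm_le_zero_iff.mp h)
    (LinearMap.range_eq_top.mpr fun g => by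
      obtain ⟨z, hz⟩ := exists_add_prim_eq_zero q (q * g)
      refine ⟨z + g, ?_⟩
      change z + g + prim (q * (z + g)) = g
      rw [mul_add, add_right_comm, hz, zero_add])

lemma coe_linEquiv (q : C0) : (linEquiv q : C0 →L[ℝ] C0) = linOp q :=
  ContinuousLinearEquiv.coe_ofBijective _ _ _

/-! ### The nonlinear equation `u + prim (f ∘ u) = g` -/

/-- The derivative of a smooth function, as a continuous function. -/
noncomputable def derivMap (f : C(ℝ, ℝ)) (hf : ContDiff ℝ ∞ f) : C(ℝ, ℝ) :=
  ⟨deriv f, hf.continuous_deriv (by simp)⟩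

lemma contDiff_derivMap {f : C(ℝ, ℝ)} (hf : ContDiff ℝ ∞ f) : ContDiff ℝ ∞ (derivMap f hf) :=
  (contDiff_infty_iff_deriv.mp hf).2

lemma hasDerivAt_derivMap {f : C(ℝ, ℝ)} (hf : ContDiff ℝ ∞ f) (x : ℝ) :
    HasDerivAt f (derivMap f hf x) x :=
  ((contDiff_infty_iff_deriv.mp hf).1 x).hasDerivAt

lemma hasFDerivAt_comp {f : C(ℝ, ℝ)} (hf : ContDiff ℝ ∞ f) (u : C0) :
    HasFDerivAt (fun u : C0 => f.comp u)
      (ContinuousLinearMap.mul ℝ C0 ((derivMap f hf).comp u)) u := by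
  have h := contDiff_infty_iff_fderiv.mp hf
  refine (hasFDerivAt_superposition hf.continuous (fun x => (h.1 x).hasFDerivAt)
    h.2.continuous u).congr_fderiv ?_
  ext w s
  change fderiv ℝ f (u s) (w s) = deriv f (u s) * w s
  rw [fderiv_eq_smul_deriv, smul_eq_mul, mul_comm]

lemma contDiff_comp {f : C(ℝ, ℝ)} (hf : ContDiff ℝ ∞ f) :
    ContDiff ℝ ∞ (fun u : C0 => f.comp u) := contDiff_superposition hf

/-- The map `u ↦ u + prim (f ∘ u)`. -/
noncomputable def addPrim (f : C(ℝ, ℝ)) (u : C0) : C0 := u + prim (f.comp u)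

lemma contDiff_addPrim {f : C(ℝ, ℝ)} (hf : ContDiff ℝ ∞ f) : ContDiff ℝ ∞ (addPrim f) :=
  contDiff_id.add (prim.contDiff.comp (contDiff_comp hf))

lemma hasFDerivAt_addPrim {f : C(ℝ, ℝ)} (hf : ContDiff ℝ ∞ f) (u : C0) :
    HasFDerivAt (addPrim f) (linEquiv ((derivMap f hf).comp u) : C0 →L[ℝ] C0) u := by
  rw [coe_linEquiv]
  exact (hasFDerivAt_id u).add (prim.hasFDerivAt.comp u (hasFDerivAt_comp hf u))

/-- Hadamard's lemma for `f (b + s) - f b`. It makes the difference of two nonlinear equations a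
linear one. -/
lemma exists_continuous_slope {f : C(ℝ, ℝ)} (hf : ContDiff ℝ ∞ f) :
    ∃ δ : C(ℝ × ℝ, ℝ), ∀ a b, f a - f b = δ (a, b) * (a - b) := by
  obtain ⟨g, hg, h, -⟩ := exists_eq_mul_of_eq_zero (T := ℝ)
    (h := fun p : ℝ × ℝ => f (p.2 + p.1) - f p.2)
    ((hf.comp (contDiff_snd.add contDiff_fst)).sub (hf.comp contDiff_snd)) (by simp)
  refine ⟨⟨fun p => g (p.1 - p.2, p.2), hg.continuous.comp (by fun_prop)⟩, fun a b => ?_⟩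
  have := h (a - b) b
  simp only [add_sub_cancel] at this
  rw [this, mul_comm]
  rfl

/-- `addPrim f u - addPrim f v` is `linOp q (u - v)` with `q` the slope of `f` between `u` and `v`,
which is bounded in terms of `R`. -/
lemma norm_sub_le_norm_addPrim_sub {f : C(ℝ, ℝ)} (hf : ContDiff ℝ ∞ f) (R : ℝ) :
    ∃ C : ℝ, 0 < C ∧ ∀ u v : C0, ‖u‖ ≤ R → ‖v‖ ≤ R →
      ‖u - v‖ ≤ C * ‖addPrim f u - addPrim f v‖ := by
  obtain ⟨δ, hδ⟩ := exists_continuous_slope hf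
  obtain ⟨B, hB⟩ := ((isCompact_Icc (a := -R) (b := R)).prod
    (isCompact_Icc (a := -R) (b := R))).exists_bound_of_continuousOn δ.continuous.continuousOn
  refine ⟨1 + 2 * Real.exp |B| ^ 2 * |B|, by positivity, fun u v hu hv => ?_⟩
  let q : C0 := ⟨fun s => δ (u s, v s), by fun_prop⟩
  have hq : ‖q‖ ≤ |B| := by
    rw [ContinuousMap.norm_le _ (abs_nonneg _)]
    intro s
    exact (hB _ ⟨abs_le.mp ((u.abs_le s).trans hu), abs_le.mp ((v.abs_le s).trans hv)⟩).trans
      (le_abs_self B)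
  have hmul : q * (u - v) = f.comp u - f.comp v := by
    ext s
    exact (hδ (u s) (v s)).symm
  have h := norm_le_norm_linOp q (u - v)
  rw [linOp_apply, hmul, map_sub] at h
  have he : addPrim f u - addPrim f v = u - v + (prim (f.comp u) - prim (f.comp v)) := by
    simp only [addPrim]; abel
  rw [← he] at h
  exact h.trans (by gcongr)

/-- At an extremum of `u - g`, where `g = u + prim (f ∘ u)`, the value of `f ∘ u` is the average
of `f ∘ u`. -/
lemma exists_extrema (f : C(ℝ, ℝ)) (u : C0) :
    (∃ s, f (u s) = mean (f.comp u) ∧ ∀ x, u x - addPrim f u x ≤ u s - addPrim f u s) ∧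
      ∃ s, f (u s) = mean (f.comp u) ∧ ∀ x, u s - addPrim f u s ≤ u x - addPrim f u x := by
  have hz : ∀ x, u x - addPrim f u x = -prim (f.comp u) x := fun x => by simp [addPrim]
  have hd : ∀ t : ℝ, IsLocalExtr (fun t : ℝ => prim (f.comp u) (t : UnitAddCircle)) t →
      f (u t) = mean (f.comp u) := fun t ht =>
    sub_eq_zero.mp (ht.hasDerivAt_eq_zero (hasDerivAt_prim (f.comp u) t))
  simp_rw [hz]
  constructor
  · obtain ⟨s, -, hs⟩ := isCompact_univ.exists_isMinOn univ_nonempty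
      (prim (f.comp u)).continuous.continuousOn
    replace hs : ∀ x, _ := fun x => hs (mem_univ x)
    obtain ⟨t, -, rfl⟩ := exists_mem_Ico_coe s
    exact ⟨t, hd t (Or.inl (Eventually.of_forall fun _ => hs _)), fun x => neg_le_neg (hs x)⟩
  · obtain ⟨s, -, hs⟩ := isCompact_univ.exists_isMaxOn univ_nonempty
      (prim (f.comp u)).continuous.continuousOn
    replace hs : ∀ x, _ := fun x => hs (mem_univ x)
    obtain ⟨t, -, rfl⟩ := exists_mem_Ico_coe s
    exact ⟨t, hd t (Or.inr (Eventually.of_forall fun _ => hs _)), fun x => neg_le_neg (hs x)⟩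

/-- Otherwise `f` along `addPrim f u` stays below the average. Where `prim (f ∘ u)` vanishes,
`addPrim f u` equals `u`, so `-prim (f ∘ u)` is strictly increasing at each zero. It starts from
`0`, hence is positive at time `1`, against periodicity. -/
lemma exists_mean_comp_le (f : C(ℝ, ℝ)) (u : C0) :
    ∃ x, mean (f.comp u) ≤ f (addPrim f u x) := by
  by_contra! hc
  have hp := fun t : ℝ => (hasDerivAt_prim (f.comp u) t).fun_neg
  have := pos_of_deriv_pos_at_zeros hp (fun t ht => by
    have h1 := hc t
    have h2 : addPrim f u (t : UnitAddCircle) = u (t : UnitAddCircle) := by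
      simpa [addPrim] using ht
    rw [h2] at h1
    have : (f.comp u) (t : UnitAddCircle) = f (u t) := rfl
    linarith) (a := 0) (b := 1) (by rw [prim_zero, neg_zero]) zero_lt_one
  rw [coe_one_circle, prim_zero, neg_zero] at this
  exact lt_irrefl _ this

lemma exists_forall_abs_gt {f : C(ℝ, ℝ)} (hlim : Tendsto f (cocompact ℝ) atTop) (A : ℝ) :
    ∃ B, 0 ≤ B ∧ ∀ x, B < |x| → A < f x := by
  have h := hlim.eventually_gt_atTop A
  rw [← Metric.cobounded_eq_cocompact, ← comap_norm_atTop, eventually_comap] at h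
  obtain ⟨B, hB⟩ := (eventually_atTop.mp h)
  exact ⟨max B 0, le_max_right _ _, fun x hx => hB _ ((le_max_left _ _).trans hx.le) x rfl⟩

/-- The average of `f ∘ u` is at most a bound of `|f|` on `[-r, r]`. At the extrema of `u - addPrim
f u` it equals `f ∘ u`, so growth of `f` bounds `u` there, hence bounds `u - addPrim f u`
everywhere. -/
lemma norm_le_of_norm_addPrim_le {f : C(ℝ, ℝ)} (hlim : Tendsto f (cocompact ℝ) atTop) (r : ℝ) :
    ∃ R, ∀ u : C0, ‖addPrim f u‖ ≤ r → ‖u‖ ≤ R := by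
  obtain ⟨M, hM⟩ := (isCompact_Icc (a := -r) (b := r)).exists_bound_of_continuousOn
    f.continuous.continuousOn
  obtain ⟨B, hB0, hB⟩ := exists_forall_abs_gt hlim M
  refine ⟨B + 2 * |r|, fun u hu => ?_⟩
  have hg : ∀ x, |addPrim f u x| ≤ r := fun x => ((addPrim f u).abs_le x).trans hu
  have hr : r ≤ |r| := le_abs_self r
  have hmean : mean (f.comp u) ≤ M := by
    obtain ⟨x, hx⟩ := exists_mean_comp_le f u
    exact hx.trans ((le_abs_self _).trans (hM _ (abs_le.mp (hg x))))
  have hs : ∀ s, f (u s) = mean (f.comp u) → |u s| ≤ B := fun s hs => by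
    by_contra! hc
    exact absurd (hB _ hc) (by rw [hs]; exact hmean.not_gt)
  obtain ⟨⟨s, h1, h2⟩, s', h3, h4⟩ := exists_extrema f u
  rw [ContinuousMap.norm_le _ (by positivity)]
  intro x
  have b1 := abs_le.mp (hs s h1)
  have b2 := abs_le.mp (hs s' h3)
  have c1 := abs_le.mp (hg s)
  have c2 := abs_le.mp (hg s')
  have c3 := abs_le.mp (hg x)
  have d1 := h2 x
  have d2 := h4 x
  rw [Real.norm_eq_abs, abs_le]
  constructor <;> linarith

/-- The range is open by the inverse function theorem. It is closed because preimages of a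
convergent sequence are bounded a priori, hence Cauchy by the difference estimate. -/
lemma addPrim_bijective {f : C(ℝ, ℝ)} (hlim : Tendsto f (cocompact ℝ) atTop)
    (hf : ContDiff ℝ ∞ f) : Function.Bijective (addPrim f) := by
  constructor
  · intro u v huv
    obtain ⟨C, -, hC⟩ := norm_sub_le_norm_addPrim_sub hf (max ‖u‖ ‖v‖)
    have := hC u v (le_max_left _ _) (le_max_right _ _)
    rw [huv, sub_self, norm_zero, mul_zero] at this
    exact sub_eq_zero.mp (norm_le_zero_iff.mp this)
  · have hopen : IsOpen (range (addPrim f)) :=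
      (isOpenMap_of_hasStrictFDerivAt_equiv fun u =>
        (contDiff_addPrim hf).contDiffAt.hasStrictFDerivAt' (hasFDerivAt_addPrim hf u)
          (by simp)).isOpen_range
    have hclosed : IsClosed (range (addPrim f)) := by
      refine IsSeqClosed.isClosed fun g a hg hga => ?_
      choose u hu using hg
      obtain ⟨r, hr⟩ := (Metric.isBounded_range_of_tendsto g hga).exists_norm_le
      obtain ⟨R, hR⟩ := norm_le_of_norm_addPrim_le hlim r
      have huR : ∀ n, ‖u n‖ ≤ R := fun n => hR _ (by rw [hu]; exact hr _ (mem_range_self n))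
      obtain ⟨C, hC0, hC⟩ := norm_sub_le_norm_addPrim_sub hf R
      have hcau : CauchySeq u := by
        rw [Metric.cauchySeq_iff]
        intro ε hε
        obtain ⟨N, hN⟩ := Metric.cauchySeq_iff.mp hga.cauchySeq (ε / C) (by positivity)
        refine ⟨N, fun m hm n hn => ?_⟩
        have h1 := hN m hm n hn
        rw [dist_eq_norm, lt_div_iff₀ hC0] at h1
        have h2 := hC _ _ (huR m) (huR n)
        rw [hu, hu] at h2
        rw [dist_eq_norm]
        linarith
      obtain ⟨v, hv⟩ := cauchySeq_tendsto_of_complete hcau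
      refine ⟨v, tendsto_nhds_unique (((contDiff_addPrim hf).continuous.tendsto v).comp hv) ?_⟩
      exact hga.congr fun n => (hu n).symm
    exact range_eq_univ.mp (IsClopen.eq_univ ⟨hclosed, hopen⟩ (range_nonempty _))

/-- The smooth global inverse of `u ↦ u + prim (f ∘ u)`. -/
lemma exists_solution {f : C(ℝ, ℝ)} (hlim : Tendsto f (cocompact ℝ) atTop)
    (hf : ContDiff ℝ ∞ f) :
    ∃ S : C0 → C0, ContDiff ℝ ∞ S ∧ (∀ g, addPrim f (S g) = g) ∧
    ∀ u, S (addPrim f u) = u := by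
  let e := Equiv.ofBijective _ (addPrim_bijective hlim hf)
  exact ⟨e.symm, contDiff_symm_of_hasFDerivAt e (contDiff_addPrim hf) fun u =>
    ⟨_, hasFDerivAt_addPrim hf u⟩, e.apply_symm_apply, e.symm_apply_apply⟩

/-- With `u = S (y + g)`, the difference `u - (y + g)` vanishes at time `0`, so its maximum is
nonnegative and its minimum nonpositive. At the maximum (for `y → +∞`) or the minimum (for `y →
-∞`), `|u|` is large while `f ∘ u` equals its average. -/
lemma tendsto_mean_comp {f : C(ℝ, ℝ)} (hlim : Tendsto f (cocompact ℝ) atTop)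
    {S : C0 → C0} (hS : ∀ g, addPrim f (S g) = g) (g : C0) :
    Tendsto (fun y : ℝ => mean (f.comp (S (ContinuousMap.const _ y + g)))) (cocompact ℝ)
      atTop := by
  rw [tendsto_atTop]
  intro A
  obtain ⟨B, hB0, hB⟩ := exists_forall_abs_gt hlim A
  rw [cocompact_eq_atBot_atTop, eventually_sup]
  have hz0 : ∀ u : C0, u ((0 : ℝ) : UnitAddCircle) - addPrim f u ((0 : ℝ) : UnitAddCircle) = 0 :=
    fun u => by simpa [addPrim] using prim_zero (f.comp u)
  constructor
  · filter_upwards [eventually_lt_atBot (-B - ‖g‖)] with y hy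
    obtain ⟨-, s, h3, h4⟩ := exists_extrema f (S (ContinuousMap.const _ y + g))
    have h5 := h4 ((0 : ℝ) : UnitAddCircle)
    rw [hz0, hS] at h5
    have h6 := abs_le.mp (g.abs_le s)
    simp only [ContinuousMap.add_apply, ContinuousMap.const_apply] at h5
    rw [← h3]
    exact (hB _ (lt_abs.mpr (Or.inr (by linarith)))).le
  · filter_upwards [eventually_gt_atTop (B + ‖g‖)] with y hy
    obtain ⟨⟨s, h3, h4⟩, -⟩ := exists_extrema f (S (ContinuousMap.const _ y + g))
    have h5 := h4 ((0 : ℝ) : UnitAddCircle)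
    rw [hz0, hS] at h5
    have h6 := abs_le.mp (g.abs_le s)
    simp only [ContinuousMap.add_apply, ContinuousMap.const_apply] at h5
    rw [← h3]
    exact (hB _ (lt_abs.mpr (Or.inl (by linarith)))).le

/-! ### Derivatives of the average along vertical lines -/

lemma hasDerivAt_comp_curve {f : C(ℝ, ℝ)} (hf : ContDiff ℝ ∞ f) {u : ℝ → C0} {u' : C0} {y : ℝ}
    (hu : HasDerivAt u u' y) :
    HasDerivAt (fun y => f.comp (u y)) ((derivMap f hf).comp (u y) * u') y :=
  (hasFDerivAt_comp hf (u y)).comp_hasDerivAt y hu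

lemma hasDerivAt_clm_curve {F : Type} [NormedAddCommGroup F] [NormedSpace ℝ F]
    (A : C0 →L[ℝ] F) {u : ℝ → C0} {u' : C0} {y : ℝ}
    (hu : HasDerivAt u u' y) : HasDerivAt (fun y => A (u y)) (A u') y :=
  A.hasFDerivAt.comp_hasDerivAt y hu

lemma hasDerivAt_const_map (g : C0) (y : ℝ) :
    HasDerivAt (fun y : ℝ => (ContinuousMap.const _ y + g : C0)) 1 y := by
  have h : (fun y : ℝ => (ContinuousMap.const _ y + g : C0)) = fun y : ℝ => y • (1 : C0) + g := by
    ext y s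
    simp
  rw [h]
  simpa using ((hasDerivAt_id y).smul_const (1 : C0)).add_const g

lemma contDiff_const_map (g : C0) :
    ContDiff ℝ ∞ fun y : ℝ => (ContinuousMap.const _ y + g : C0) := by
  have h : (fun y : ℝ => (ContinuousMap.const _ y + g : C0)) = fun y : ℝ => y • (1 : C0) + g := by
    ext y s
    simp
  rw [h]
  fun_prop

/-- At a critical point the derivative `w` in the initial value is the reciprocal of the integrating
factor; in particular it is positive. -/
lemma mul_expInt_eq_one {q w : C0} (hw : w + prim (q * w) = 1) (h0 : mean (q * w) = 0)
    {t : ℝ} : w (t : UnitAddCircle) * expInt q t = 1 := by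
  have h := mul_expInt_eq (q := q) (r := 0) (x := w) (c := 1) (by rw [add_zero, hw]; rfl) t
  rw [h, add_zero, h0]
  simp

/-- The integral is positive, so criticality amounts to `mean q = 0`. -/
lemma mean_mul_integral_expInt_one {q w : C0} (hw : w + prim (q * w) = 1) :
    mean (q * w) * ∫ s in (0 : ℝ)..1, expInt q s = Real.exp (mean q) - 1 := by
  have h := mean_mul_integral_expInt (q := q) (r := 0) (x := w) (c := 1)
    (by rw [add_zero, hw]; rfl)
  rw [add_zero] at h
  rw [h]
  simp

/-- The average of `q * x + a * w` when `w` solves the homogeneous equation. -/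
lemma mean_mul_integral_expInt_of_mul {q w a x : C0} (hw : w + prim (q * w) = 1)
    (h0 : mean (q * w) = 0) (hx : x + prim (q * x + a * w) = 0) :
    mean (q * x + a * w) * ∫ s in (0 : ℝ)..1, expInt q s = mean a := by
  have h := mean_mul_integral_expInt (q := q) (r := a * w) (x := x) (c := 0)
    (by rw [hx]; rfl)
  rw [h, zero_mul, add_zero, mean_eq]
  refine intervalIntegral.integral_congr fun s _ => ?_
  simp only [ContinuousMap.mul_apply]
  rw [mul_assoc, mul_expInt_eq_one hw h0, mul_one]

/-- The third order term when the second order term vanishes. -/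
lemma mean_third {q w a b z x : C0} (hw : w + prim (q * w) = 1)
    (h0 : mean (q * w) = 0) (hz : z + prim (q * z + a * w * w) = 0)
    (h1 : mean (q * z + a * w * w) = 0)
    (hx : x + prim (q * x + (3 * a * z + b * w * w) * w) = 0) :
    mean (q * x + (3 * a * z + b * w * w) * w) * ∫ s in (0 : ℝ)..1, expInt q s
      = mean (b * w * w) := by
  have hE := fun t : ℝ => mul_expInt_eq_one hw h0 (t := t)
  have haw : mean (a * w) = 0 := by
    rw [← mean_mul_integral_expInt_of_mul hw h0 hz, h1, zero_mul]
  have hzt : ∀ t : ℝ, z (t : UnitAddCircle)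
      = -(w (t : UnitAddCircle) * ∫ s in (0 : ℝ)..t, (a * w) (s : UnitAddCircle)) := by
    intro t
    have h := mul_expInt_eq (q := q) (r := a * w * w) (x := z) (c := 0) (by rw [hz]; rfl) t
    have h2 : ∫ s in (0 : ℝ)..t,
        (mean (q * z + a * w * w) - (a * w * w) (s : UnitAddCircle)) * expInt q s
        = -∫ s in (0 : ℝ)..t, (a * w) (s : UnitAddCircle) := by
      rw [← intervalIntegral.integral_neg]
      refine intervalIntegral.integral_congr fun s _ => ?_
      simp only [h1, ContinuousMap.mul_apply]
      linear_combination (-(a (s : UnitAddCircle) * w (s : UnitAddCircle))) * hE s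
    rw [h2, zero_add] at h
    linear_combination (w (t : UnitAddCircle)) * h - z (t : UnitAddCircle) * hE t
  -- With `A(t) = ∫₀ᵗ a w` one has `a z = -A A'`, and `A(1) = mean (a * w) = 0` because the second
  -- order term vanishes.
  have haz : mean (a * z) = 0 := by
    have hd : ∀ t : ℝ, HasDerivAt
        (fun t : ℝ => -(∫ s in (0 : ℝ)..t, (a * w) (s : UnitAddCircle)) ^ 2 / 2)
        ((a * z) (t : UnitAddCircle)) t := by
      intro t
      refine ((hasDerivAt_integral (a * w) t).fun_pow 2).fun_neg.div_const 2 |>.congr_deriv ?_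
      simp only [ContinuousMap.mul_apply, hzt]
      ring
    rw [mean_eq, intervalIntegral.integral_eq_sub_of_hasDerivAt (fun s _ => hd s)
      ((a * z).intervalIntegrable _ _), ← mean_eq, haw]
    simp
  rw [mean_mul_integral_expInt_of_mul hw h0 hx, map_add]
  have : mean (3 * a * z) = 3 * mean (a * z) := by
    rw [mul_assoc, ← smul_eq_mul (3 : ℝ), ← map_smul]
    congr 1
  rw [this, haz, mul_zero, zero_add]

/-! ### The first three derivatives of the average along a vertical line -/

section Line

variable {f : C(ℝ, ℝ)} (hf : ContDiff ℝ ∞ f)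

/-- The second derivative as a continuous function. -/
noncomputable abbrev derivMap₂ : C(ℝ, ℝ) := derivMap (derivMap f hf) (contDiff_derivMap hf)

/-- The third derivative as a continuous function. -/
noncomputable abbrev derivMap₃ : C(ℝ, ℝ) :=
  derivMap (derivMap₂ hf) (contDiff_derivMap (contDiff_derivMap hf))

variable {u : ℝ → C0} (hu : ContDiff ℝ ∞ u) {g : C0}
  (hg : ∀ y, addPrim f (u y) = ContinuousMap.const _ y + g)

lemma hasDerivAt_of_contDiff {F : Type} [NormedAddCommGroup F] [NormedSpace ℝ F] {u : ℝ → F}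
    (hu : ContDiff ℝ ∞ u) (y : ℝ) : HasDerivAt u (deriv u y) y ∧ ContDiff ℝ ∞ (deriv u) :=
  ⟨((contDiff_infty_iff_deriv.mp hu).1 y).hasDerivAt, (contDiff_infty_iff_deriv.mp hu).2⟩

include hu in
lemma deriv_mean (y : ℝ) :
    deriv (fun y => mean (f.comp (u y))) y = mean ((derivMap f hf).comp (u y) * deriv u y) :=
  (hasDerivAt_clm_curve mean
    (hasDerivAt_comp_curve hf (hasDerivAt_of_contDiff hu y).1)).deriv

include hu hg in
lemma deriv_line (y : ℝ) : deriv u y + prim ((derivMap f hf).comp (u y) * deriv u y) = 1 := by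
  have h := (hasDerivAt_of_contDiff hu y).1
  have h1 := h.fun_add (hasDerivAt_clm_curve prim (hasDerivAt_comp_curve hf h))
  refine h1.unique ?_
  exact (hasDerivAt_const_map g y).congr_of_eventuallyEq (Eventually.of_forall hg)

include hu in
lemma deriv_mean_two (y : ℝ) :
    deriv (deriv fun y => mean (f.comp (u y))) y
      = mean ((derivMap f hf).comp (u y) * deriv (deriv u) y
        + (derivMap₂ hf).comp (u y) * deriv u y * deriv u y) := by
  have h := (hasDerivAt_of_contDiff hu y)
  have h' := hasDerivAt_of_contDiff h.2 y
  rw [funext (deriv_mean hf hu)]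
  rw [(hasDerivAt_clm_curve mean
    ((hasDerivAt_comp_curve (contDiff_derivMap hf) h.1).fun_mul h'.1)).deriv]
  congr 1
  ring

include hu hg in
lemma deriv_line_two (y : ℝ) :
    deriv (deriv u) y + prim ((derivMap f hf).comp (u y) * deriv (deriv u) y
      + (derivMap₂ hf).comp (u y) * deriv u y * deriv u y) = 0 := by
  have h := (hasDerivAt_of_contDiff hu y)
  have h' := hasDerivAt_of_contDiff h.2 y
  have h1 := h'.1.fun_add (hasDerivAt_clm_curve prim
    ((hasDerivAt_comp_curve (contDiff_derivMap hf) h.1).fun_mul h'.1))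
  have h2 := h1.unique ((hasDerivAt_const y (1 : C0)).congr_of_eventuallyEq
    (Eventually.of_forall (deriv_line hf hu hg)))
  rw [← h2, add_comm ((derivMap f hf).comp (u y) * deriv (deriv u) y)]

lemma hasDerivAt_second_order {y : ℝ} (hu : ContDiff ℝ ∞ u) :
    HasDerivAt (fun y => (derivMap f hf).comp (u y) * deriv (deriv u) y
      + (derivMap₂ hf).comp (u y) * deriv u y * deriv u y)
      ((derivMap f hf).comp (u y) * deriv (deriv (deriv u)) y
        + (3 * (derivMap₂ hf).comp (u y) * deriv (deriv u) y
          + (derivMap₃ hf).comp (u y) * deriv u y * deriv u y) * deriv u y) y := by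
  have h := (hasDerivAt_of_contDiff hu y)
  have h' := hasDerivAt_of_contDiff h.2 y
  have h'' := hasDerivAt_of_contDiff h'.2 y
  have e1 := hasDerivAt_comp_curve (contDiff_derivMap hf) h.1
  have e2 := hasDerivAt_comp_curve (contDiff_derivMap (contDiff_derivMap hf)) h.1
  refine ((e1.fun_mul h''.1).fun_add ((e2.fun_mul h'.1).fun_mul h'.1)).congr_deriv ?_
  ring

include hu in
lemma deriv_mean_three (y : ℝ) :
    deriv (deriv (deriv fun y => mean (f.comp (u y)))) y
      = mean ((derivMap f hf).comp (u y) * deriv (deriv (deriv u)) y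
        + (3 * (derivMap₂ hf).comp (u y) * deriv (deriv u) y
          + (derivMap₃ hf).comp (u y) * deriv u y * deriv u y) * deriv u y) := by
  rw [funext (deriv_mean_two hf hu)]
  exact (hasDerivAt_clm_curve mean (hasDerivAt_second_order hf hu)).deriv

include hu hg in
lemma deriv_line_three (y : ℝ) :
    deriv (deriv (deriv u)) y + prim ((derivMap f hf).comp (u y) * deriv (deriv (deriv u)) y
        + (3 * (derivMap₂ hf).comp (u y) * deriv (deriv u) y
          + (derivMap₃ hf).comp (u y) * deriv u y * deriv u y) * deriv u y) = 0 := by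
  have h := (hasDerivAt_of_contDiff hu y)
  have h' := hasDerivAt_of_contDiff h.2 y
  have h'' := hasDerivAt_of_contDiff h'.2 y
  have h1 := h''.1.fun_add (hasDerivAt_clm_curve prim (hasDerivAt_second_order hf hu (y := y)))
  exact h1.unique ((hasDerivAt_const y (0 : C0)).congr_of_eventuallyEq
    (Eventually.of_forall (deriv_line_two hf hu hg)))

include hu hg in
lemma deriv_mean_mul (y : ℝ) :
    deriv (fun y => mean (f.comp (u y))) y
      * ∫ s in (0 : ℝ)..1, expInt ((derivMap f hf).comp (u y)) s
      = Real.exp (mean ((derivMap f hf).comp (u y))) - 1 := by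
  rw [deriv_mean hf hu]
  exact mean_mul_integral_expInt_one (deriv_line hf hu hg y)

include hu hg in
lemma deriv_mean_two_mul {y : ℝ} (h1 : deriv (fun y => mean (f.comp (u y))) y = 0) :
    deriv (deriv fun y => mean (f.comp (u y))) y
      * ∫ s in (0 : ℝ)..1, expInt ((derivMap f hf).comp (u y)) s
      = mean ((derivMap₂ hf).comp (u y) * deriv u y) := by
  rw [deriv_mean hf hu] at h1
  rw [deriv_mean_two hf hu]
  exact mean_mul_integral_expInt_of_mul (deriv_line hf hu hg y) h1 (deriv_line_two hf hu hg y)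

include hu hg in
lemma deriv_mean_three_mul {y : ℝ} (h1 : deriv (fun y => mean (f.comp (u y))) y = 0)
    (h2 : deriv (deriv fun y => mean (f.comp (u y))) y = 0) :
    deriv (deriv (deriv fun y => mean (f.comp (u y)))) y
      * ∫ s in (0 : ℝ)..1, expInt ((derivMap f hf).comp (u y)) s
      = mean ((derivMap₃ hf).comp (u y) * deriv u y * deriv u y) := by
  rw [deriv_mean hf hu] at h1
  rw [deriv_mean_two hf hu] at h2
  rw [deriv_mean_three hf hu]
  exact mean_third (deriv_line hf hu hg y) h1 (deriv_line_two hf hu hg y) h2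
    (deriv_line_three hf hu hg y)

end Line

/-! ### Consequences of goodness and of the position of the origin -/

lemma IsGood.exists_ne_zero {k : ℕ} {f : ℝ → ℝ} (h : IsGood k f)
    {l : (Fin k → ℝ) →ₗ[ℝ] ℝ} (hl : l ≠ 0) {a b : ℝ} (hab : a < b) :
    ∃ x ∈ Ioo a b, l (gammaHat k f x) ≠ 0 := by
  have h1 := h.2 a b hab (LinearMap.ker l) (by
    simpa using Module.Dual.finrank_ker_add_one_of_ne_zero (K := ℝ) (f := l) hl)
  rw [image_subset_iff, not_subset] at h1
  exact h1

/-- If the hull has interior, the origin is separated from it and the sign passes to the closure. If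
not, `s` lies in a proper affine subspace, and some nonzero functional is constant on `s`; its sign
is then adjusted. -/
lemma exists_nonneg_functional {V : Type} [NormedAddCommGroup V] [NormedSpace ℝ V]
    [FiniteDimensional ℝ V] {s : Set V} (hs : s.Nonempty) (h : (0 : V) ∉ interior (convexHull ℝ s)) :
    ∃ l : V →ₗ[ℝ] ℝ, l ≠ 0 ∧ ∀ x ∈ s, 0 ≤ l x := by
  by_cases hi : (interior (convexHull ℝ s)).Nonempty
  · obtain ⟨l, hl⟩ := geometric_hahn_banach_open_point (convex_convexHull ℝ s).interior
      isOpen_interior h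
    simp only [map_zero] at hl
    refine ⟨-l.toLinearMap, ?_, fun x hx => ?_⟩
    · obtain ⟨x, hx⟩ := hi
      intro h0
      have h1 := hl x hx
      have h2 : -l x = 0 := congrArg (fun m : V →ₗ[ℝ] ℝ => m x) h0
      linarith
    · have hx' : x ∈ closure (interior (convexHull ℝ s)) := by
        rw [(convex_convexHull ℝ s).closure_interior_eq_closure_of_nonempty_interior hi]
        exact subset_closure (subset_convexHull ℝ s hx)
      have : l x ≤ 0 := closure_minimal (fun y hy => (hl y hy).le)
        (isClosed_le l.continuous continuous_const) hx'
      simpa using this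
  · rw [interior_convexHull_nonempty_iff_affineSpan_eq_top,
      ← AffineSubspace.direction_eq_top_iff_of_nonempty ((affineSpan_nonempty ℝ).mpr hs)] at hi
    obtain ⟨l, hl, hle⟩ := Submodule.exists_le_ker_of_lt_top _ (lt_top_iff_ne_top.mpr hi)
    obtain ⟨x₀, hx₀⟩ := hs
    have hconst : ∀ x ∈ s, l x = l x₀ := fun x hx => by
      have : l (x -ᵥ x₀) = 0 := hle (by
        rw [direction_affineSpan]
        exact vsub_mem_vectorSpan ℝ hx hx₀)
      rw [vsub_eq_sub, map_sub] at this
      linarith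
    rcases le_total 0 (l x₀) with h0 | h0
    · exact ⟨l, hl, fun x hx => by rwa [hconst x hx]⟩
    · exact ⟨-l, neg_ne_zero.mpr hl, fun x hx => by simpa [hconst x hx] using h0⟩

/-- A bounded piece of the curve suffices: its hull already contains positive multiples of `±bᵢ` for
a basis `b`, and a functional that is nonnegative on all of these is zero. -/
lemma exists_bounded_neg_functional {V : Type} [NormedAddCommGroup V] [NormedSpace ℝ V]
    [FiniteDimensional ℝ V] {γ : ℝ → V} (h : (0 : V) ∈ interior (convexHull ℝ (range γ))) :
    ∃ M : ℝ, 0 < M ∧ ∀ l : V →ₗ[ℝ] ℝ, l ≠ 0 → ∃ x ∈ Icc (-M) M, l (γ x) < 0 := by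
  set A : ℕ → Set V := fun n => convexHull ℝ (γ '' Icc (-(n : ℝ)) n) with hA
  have hmono : Monotone A := fun m n hmn => convexHull_mono (image_mono
    (Icc_subset_Icc (neg_le_neg (Nat.cast_le.mpr hmn)) (Nat.cast_le.mpr hmn)))
  have hsub : convexHull ℝ (range γ) ⊆ ⋃ n, A n := by
    refine convexHull_min ?_ (hmono.directed_le.convex_iUnion fun n => convex_convexHull ℝ _)
    rintro _ ⟨x, rfl⟩
    obtain ⟨n, hn⟩ := exists_nat_ge |x|
    exact mem_iUnion.mpr ⟨n, subset_convexHull ℝ _ ⟨x, abs_le.mp hn, rfl⟩⟩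
  let b := Module.finBasis ℝ V
  have hev : ∀ v : V, ∃ ε : ℝ, 0 < ε ∧ ∃ n, ε • v ∈ A n := by
    intro v
    have h1 : ∀ᶠ ε : ℝ in 𝓝[>] 0, ε • v ∈ convexHull ℝ (range γ) := by
      have hc : Tendsto (fun ε : ℝ => ε • v) (𝓝 0) (𝓝 0) := by
        have hc : Continuous fun ε : ℝ => ε • v := by fun_prop
        simpa using hc.tendsto 0
      exact (hc.eventually (mem_interior_iff_mem_nhds.mp h)).filter_mono nhdsWithin_le_nhds
    obtain ⟨ε, hε, hε0⟩ := (h1.and self_mem_nhdsWithin).exists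
    exact ⟨ε, hε0, mem_iUnion.mp (hsub hε)⟩
  choose e he n hn using hev
  obtain ⟨N, hN⟩ : ∃ N : ℕ, ∀ i, n (b i) ≤ N ∧ n (-b i) ≤ N := by
    obtain ⟨N₁, h₁⟩ := (finite_range fun i => n (b i)).bddAbove
    obtain ⟨N₂, h₂⟩ := (finite_range fun i => n (-b i)).bddAbove
    exact ⟨max N₁ N₂, fun i => ⟨(h₁ (mem_range_self i)).trans (le_max_left _ _),
      (h₂ (mem_range_self i)).trans (le_max_right _ _)⟩⟩
  -- The added `1` only ensures a positive bound, as `N` may be `0`.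
  refine ⟨N + 1, by positivity, fun l hl => ?_⟩
  by_contra! hc
  have hpos : ∀ v ∈ A N, 0 ≤ l v := by
    intro v hv
    refine convexHull_min (t := {v | 0 ≤ l v}) ?_ (convex_halfSpace_ge l.isLinear 0) hv
    rintro _ ⟨x, hx, rfl⟩
    exact hc x ⟨by linarith [hx.1], by linarith [hx.2]⟩
  refine hl (b.ext fun i => ?_)
  have h1 := hpos _ (hmono (hN i).1 (hn (b i)))
  have h2 := hpos _ (hmono (hN i).2 (hn (-b i)))
  rw [map_smul, smul_eq_mul] at h1 h2
  have h3 := nonneg_of_mul_nonneg_right h1 (he _)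
  have h4 := nonneg_of_mul_nonneg_right h2 (he _)
  rw [map_neg] at h4
  simp only [LinearMap.zero_apply]
  linarith

section Curve

variable {f : C(ℝ, ℝ)} (hf : ContDiff ℝ ∞ f)

lemma gammaHat_zero (k : ℕ) (x : ℝ) : gammaHat (k + 1) f x 0 = derivMap f hf x := by
  simp [gammaHat, derivMap, iteratedDeriv_one]

lemma gammaHat_one (k : ℕ) (x : ℝ) : gammaHat (k + 2) f x 1 = derivMap₂ hf x := by
  simp [gammaHat, derivMap, iteratedDeriv_succ]

lemma gammaHat_two (x : ℝ) : gammaHat 3 f x 2 = derivMap₃ hf x := by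
  simp [gammaHat, derivMap, iteratedDeriv_succ]

lemma IsGood.not_both_zero (h2 : IsGood 2 f) (x : ℝ) (h : derivMap f hf x = 0) :
    derivMap₂ hf x ≠ 0 := by
  intro h'
  refine h2.1 x ?_
  ext i
  fin_cases i
  · simpa [h] using gammaHat_zero hf 1 x
  · simpa [h'] using gammaHat_one hf 0 x

/-- The linear functional with given coefficients. -/
noncomputable def coeffFunctional {k : ℕ} (c : Fin k → ℝ) : (Fin k → ℝ) →ₗ[ℝ] ℝ :=
  ∑ i, c i • LinearMap.proj i

lemma coeffFunctional_apply {k : ℕ} (c v : Fin k → ℝ) :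
    coeffFunctional c v = ∑ i, c i * v i := by
  simp [coeffFunctional]

lemma coeffFunctional_ne_zero {k : ℕ} {c : Fin k → ℝ} {i : Fin k} (hc : c i ≠ 0) :
    coeffFunctional c ≠ 0 := by
  intro h
  have := congrArg (fun l : (Fin k → ℝ) →ₗ[ℝ] ℝ => l (Pi.single i 1)) h
  simp [coeffFunctional_apply, Pi.single_apply] at this
  exact hc this

lemma IsGood.two_exists_ne (h2 : IsGood 2 f) {a b x y : ℝ} (hb : b ≠ 0) (hxy : x < y) :
    ∃ s ∈ Ioo x y, a * derivMap f hf s + b * derivMap₂ hf s ≠ 0 := by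
  obtain ⟨s, hs, h⟩ := h2.exists_ne_zero
    (coeffFunctional_ne_zero (c := ![a, b]) (i := 1) (by simpa using hb)) hxy
  rw [coeffFunctional_apply] at h
  refine ⟨s, hs, ?_⟩
  simpa [gammaHat_zero hf 1, gammaHat_one hf 0] using h

lemma IsGood.three_exists_ne (h3 : IsGood 3 f) {a b c x y : ℝ} (hc : c ≠ 0) (hxy : x < y) :
    ∃ s ∈ Ioo x y, a * derivMap f hf s + b * derivMap₂ hf s + c * derivMap₃ hf s ≠ 0 := by
  obtain ⟨s, hs, h⟩ := h3.exists_ne_zero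
    (coeffFunctional_ne_zero (c := ![a, b, c]) (i := 2) (by simpa using hc)) hxy
  rw [coeffFunctional_apply] at h
  refine ⟨s, hs, ?_⟩
  simpa [Fin.sum_univ_three, gammaHat_zero hf 2, gammaHat_one hf 1, gammaHat_two hf] using h

/-- If a combination of `f'` and `f''` vanishes along `u`, and `f'` has average zero along `u`, then
the combination is trivial in `f''`. -/
lemma exists_ne_zero_along (h2 : IsGood 2 f) {u : C0} (hu : mean ((derivMap f hf).comp u) = 0)
    {a b : ℝ} (hb : b ≠ 0) : ∃ s, a * derivMap f hf (u s) + b * derivMap₂ hf (u s) ≠ 0 := by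
  by_contra! hc
  -- A constant `u` sits at a zero of `f'`, where `f''` cannot vanish; a nonconstant one covers an
  -- interval, on which goodness applies.
  by_cases hconst : ∀ t : ℝ, u t = u ((0 : ℝ) : UnitAddCircle)
  · have h0 : derivMap f hf (u ((0 : ℝ) : UnitAddCircle)) = 0 := by
      rw [mean_eq] at hu
      simpa [hconst] using hu
    have h1 := hc ((0 : ℝ) : UnitAddCircle)
    rw [h0, mul_zero, zero_add, mul_eq_zero] at h1
    exact h1.elim hb (IsGood.not_both_zero hf h2 _ h0)
  · push Not at hconst
    obtain ⟨t, ht⟩ := hconst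
    have hivt : uIcc (u (t : UnitAddCircle)) (u ((0 : ℝ) : UnitAddCircle)) ⊆
        range fun t : ℝ => u (t : UnitAddCircle) :=
      (intermediate_value_uIcc u.continuous_coe.continuousOn).trans (image_subset_range _ _)
    have hlt : min (u (t : UnitAddCircle)) (u ((0 : ℝ) : UnitAddCircle))
        < max (u (t : UnitAddCircle)) (u ((0 : ℝ) : UnitAddCircle)) := min_lt_max.mpr ht
    obtain ⟨x, hx, hne⟩ := IsGood.two_exists_ne hf h2 (a := a) hb hlt
    obtain ⟨s, hs⟩ := hivt (Ioo_subset_Icc_self hx)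
    exact hne (hs ▸ hc (s : UnitAddCircle))

lemma mean_pos_of_nonneg {k : C0} (hk : ∀ s, 0 ≤ k s) {s : UnitAddCircle} (hs : k s ≠ 0) :
    0 < mean k := by
  rw [mean_eq_integral]
  exact k.continuous.integral_pos_of_hasCompactSupport_nonneg_nonzero
    (HasCompactSupport.of_compactSpace _) hk hs

/-- Integrate `a f'(u) + b f''(u) ≥ 0`, which is not identically zero, against `w > 0`: the `f'`
term contributes nothing. -/
lemma mean_deriv_two_pos (h2 : IsGood 2 f) {a b : ℝ} (hb : 0 < b)
    (hab : ∀ x, 0 ≤ a * derivMap f hf x + b * derivMap₂ hf x) {u w : C0} (hw : ∀ s, 0 < w s)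
    (hu : mean ((derivMap f hf).comp u) = 0) (huw : mean ((derivMap f hf).comp u * w) = 0) :
    0 < mean ((derivMap₂ hf).comp u * w) := by
  obtain ⟨s, hs⟩ := exists_ne_zero_along hf h2 hu (a := a) hb.ne'
  have h := mean_pos_of_nonneg
    (k := a • ((derivMap f hf).comp u * w) + b • ((derivMap₂ hf).comp u * w)) (s := s)
    (fun s => by
      have := mul_nonneg (hab (u s)) (hw s).le
      simp only [ContinuousMap.add_apply, ContinuousMap.smul_apply, ContinuousMap.mul_apply,
        ContinuousMap.comp_apply, smul_eq_mul]
      linarith)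
    (by
      have := mul_ne_zero hs (hw s).ne'
      simp only [ContinuousMap.add_apply, ContinuousMap.smul_apply, ContinuousMap.mul_apply,
        ContinuousMap.comp_apply, smul_eq_mul]
      rwa [add_mul, mul_assoc, mul_assoc] at this)
  rw [map_add, map_smul, map_smul, huw, smul_zero, zero_add, smul_eq_mul] at h
  exact pos_of_mul_pos_right h hb.le

/-- The supporting functional has `b ≥ 0`, as seen at a minimum of `f`, where `f' = 0` and `f'' >
0`; and `b = 0` would make `f` monotone, against its two limits. -/
lemma exists_nonneg_combination (h2 : IsGood 2 f) (hlim : Tendsto f (cocompact ℝ) atTop)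
    (h : (0 : Fin 2 → ℝ) ∉ interior (convexHull ℝ (range (gammaHat 2 f)))) :
    ∃ a b : ℝ, 0 < b ∧ ∀ x, 0 ≤ a * derivMap f hf x + b * derivMap₂ hf x := by
  obtain ⟨l, hl, hnn⟩ := exists_nonneg_functional (range_nonempty _) h
  have hl_apply : ∀ v : Fin 2 → ℝ, l v = l (Pi.single 0 1) * v 0 + l (Pi.single 1 1) * v 1 := by
    intro v
    conv_lhs => rw [← Finset.univ_sum_single v]
    rw [map_sum, Fin.sum_univ_two]
    have : ∀ i, l (Pi.single i (v i)) = l (Pi.single i 1) * v i := fun i => by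
      rw [mul_comm, ← smul_eq_mul, ← map_smul, ← Pi.single_smul, smul_eq_mul, mul_one]
    rw [this, this]
  set a := l (Pi.single 0 1)
  set b := l (Pi.single 1 1)
  have hab : ∀ x, 0 ≤ a * derivMap f hf x + b * derivMap₂ hf x := fun x => by
    have := hnn _ (mem_range_self x)
    rwa [hl_apply, gammaHat_zero hf 1, gammaHat_one hf 0] at this
  refine ⟨a, b, ?_, hab⟩
  obtain ⟨x₀, hx₀⟩ := f.continuous.exists_forall_le hlim
  have hd0 : derivMap f hf x₀ = 0 :=
    IsLocalMin.hasDerivAt_eq_zero (Eventually.of_forall hx₀) (hasDerivAt_derivMap hf x₀)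
  have hd2 : 0 < derivMap₂ hf x₀ := by
    refine lt_of_le_of_ne ?_ (IsGood.not_both_zero hf h2 x₀ hd0).symm
    by_contra! hneg
    -- The point would be both a local maximum and a minimum, so `f` would be locally constant with
    -- `f'' = 0`.
    have hmax : IsLocalMax f x₀ := isLocalMax_of_deriv_deriv_neg hneg hd0 f.continuous.continuousAt
    have heq : (f : ℝ → ℝ) =ᶠ[𝓝 x₀] fun _ => f x₀ := by
      filter_upwards [hmax] with x hx
      exact le_antisymm hx (hx₀ x)
    have h1 : deriv (deriv f) x₀ = 0 := by
      rw [heq.deriv.deriv_eq]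
      simp
    exact hneg.ne h1
  have hb : 0 ≤ b := by
    have := hab x₀
    rw [hd0, mul_zero, zero_add] at this
    exact nonneg_of_mul_nonneg_left this hd2
  refine hb.lt_of_ne fun hb0 => ?_
  have hb0' : b = 0 := hb0.symm
  have ha : a ≠ 0 := by
    intro ha
    refine hl (LinearMap.ext fun v => ?_)
    rw [hl_apply, ha, hb0']
    simp
  simp only [hb0', zero_mul, add_zero] at hab
  obtain ⟨hbot, htop⟩ := tendsto_sup.mp (cocompact_eq_atBot_atTop (α := ℝ) ▸ hlim)
  rcases ha.lt_or_gt with ha | ha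
  · have hanti : Antitone f := antitone_of_hasDerivAt_nonpos (hasDerivAt_derivMap hf) fun x =>
      nonpos_of_mul_nonneg_right (hab x) ha
    obtain ⟨y, hy, hy'⟩ := ((htop.eventually_gt_atTop (f 0)).and (eventually_ge_atTop (0 : ℝ))).exists
    exact absurd (hanti hy') hy.not_ge
  · have hmono : Monotone f := monotone_of_hasDerivAt_nonneg (hasDerivAt_derivMap hf) fun x =>
      nonneg_of_mul_nonneg_right (hab x) ha
    obtain ⟨y, hy, hy'⟩ := ((hbot.eventually_gt_atTop (f 0)).and (eventually_le_atBot (0 : ℝ))).exists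
    exact absurd (hmono hy') hy.not_ge

end Curve

/-! ### Reparametrization of the circle -/

lemma coe_add_nat (x : ℝ) (n : ℕ) : ((x + n : ℝ) : UnitAddCircle) = x := by
  rw [AddCircle.coe_add]
  have : ((n : ℝ) : UnitAddCircle) = 0 := by
    rw [AddCircle.coe_eq_zero_iff]
    exact ⟨n, by simp⟩
  rw [this, add_zero]

/-- The continuous function on the circle given by a periodic function on the line. -/
noncomputable def ofPeriodic (F : ℝ → ℝ) (hF : Continuous F) (hp : Function.Periodic F 1) : C0 :=
  ⟨hp.lift, continuous_coinduced_dom.mpr hF⟩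

lemma ofPeriodic_coe {F : ℝ → ℝ} (hF : Continuous F) (hp : Function.Periodic F 1) (t : ℝ) :
    ofPeriodic F hF hp (t : UnitAddCircle) = F t := hp.lift_coe t

lemma integral_nat (u : C0) (n : ℕ) :
    ∫ s in (0 : ℝ)..n, u (s : UnitAddCircle) = n * mean u := by
  have h := prim_apply_real u n
  have h0 := coe_add_nat 0 n
  rw [zero_add] at h0
  rw [h0, prim_zero] at h
  linarith

/-- `σ` inverts `τ(s) = ∫₀ˢ r`. Since `τ(s + n) = τ(s) + n * mean r = τ(s) + 1`, it makes `n` turns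
in unit time. -/
lemma exists_inverse_primitive {r : C0} (hr : ∀ s, 0 < r s) {n : ℕ} (hn : mean r * n = 1) :
    ∃ σ : ℝ → ℝ, σ 0 = 0 ∧ (∀ x, σ (x + 1) = σ x + n) ∧
      ∀ x, HasDerivAt σ (r (σ x : UnitAddCircle))⁻¹ x := by
  set τ : ℝ → ℝ := fun s => ∫ x in (0 : ℝ)..s, r (x : UnitAddCircle) with hτ
  have hd : ∀ s : ℝ, HasDerivAt τ (r (s : UnitAddCircle)) s := hasDerivAt_integral r
  have hmono : StrictMono τ := strictMono_of_hasDerivAt_pos hd fun s => hr _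
  have hτ' : ∀ s, τ s = prim r (s : UnitAddCircle) + s * mean r := fun s => by
    rw [prim_apply_real]; ring
  have hm : 0 < mean r := mean_pos_of_nonneg (fun s => (hr s).le) (hr 0).ne'
  have hc : Continuous τ := continuous_iff_continuousAt.mpr fun s => (hd s).continuousAt
  have hsurj : Function.Surjective τ := by
    refine hc.surjective ?_ ?_
    · refine tendsto_atTop_mono (f := fun s => -‖prim r‖ + s * mean r) (fun s => ?_)
        (tendsto_atTop_add_const_left _ _ (tendsto_id.atTop_mul_const hm))
      rw [hτ']
      linarith [neg_le_of_abs_le ((prim r).abs_le s)]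
    · refine tendsto_atBot_mono (f := fun s => ‖prim r‖ + s * mean r) (fun s => ?_)
        (tendsto_atBot_add_const_left _ _ (tendsto_id.atBot_mul_const hm))
      rw [hτ']
      linarith [le_of_abs_le ((prim r).abs_le s)]
  let e := hmono.orderIsoOfSurjective τ hsurj
  have hleft : ∀ s, e.symm (τ s) = s := e.symm_apply_apply
  have hright : ∀ x, τ (e.symm x) = x := e.apply_symm_apply
  refine ⟨e.symm, ?_, fun x => ?_, fun x => ?_⟩
  · have : τ 0 = 0 := by simp [hτ]
    rw [← this, hleft]
    exact this.symm
  · rw [← hleft (e.symm x + n)]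
    congr 1
    rw [hτ', coe_add_nat, add_mul, ← add_assoc, ← hτ', hright, mul_comm (n : ℝ), hn]
  · exact HasDerivAt.of_local_left_inverse e.symm.continuous.continuousAt (hd _) (hr _).ne'
      (Eventually.of_forall hright)

/-- A change of variable on the circle covering it `n` times. -/
lemma exists_reparametrization {r : C0} (hr : ∀ s, 0 < r s) {n : ℕ} (hn : mean r * n = 1) :
    ∃ φ : C(UnitAddCircle, UnitAddCircle), φ ((0 : ℝ) : UnitAddCircle) = ((0 : ℝ) : UnitAddCircle) ∧
      (∀ Y Y' : C0, (∀ t : ℝ, HasDerivAt (fun t : ℝ => Y (t : UnitAddCircle))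
        ((Y' * r) (t : UnitAddCircle)) t) → ∀ t : ℝ,
        HasDerivAt (fun t : ℝ => Y.comp φ (t : UnitAddCircle)) (Y'.comp φ (t : UnitAddCircle)) t) ∧
      ∀ Y : C0, mean (Y.comp φ) = n * mean (Y * r) := by
  obtain ⟨σ, hσ0, hσp, hσd⟩ := exists_inverse_primitive hr hn
  have hσc : Continuous σ := continuous_iff_continuousAt.mpr fun x => (hσd x).continuousAt
  have hper : Function.Periodic (fun x : ℝ => (σ x : UnitAddCircle)) 1 := fun x => by
    simp only
    rw [hσp, coe_add_nat]
  have hderiv : ∀ Y Y' : C0, (∀ t : ℝ, HasDerivAt (fun t : ℝ => Y (t : UnitAddCircle))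
      ((Y' * r) (t : UnitAddCircle)) t) → ∀ t : ℝ,
      HasDerivAt (fun t : ℝ => Y (σ t : UnitAddCircle)) (Y' (σ t : UnitAddCircle)) t := by
    intro Y Y' h t
    refine ((h (σ t)).comp t (hσd t)).congr_deriv ?_
    rw [ContinuousMap.mul_apply, mul_assoc, mul_inv_cancel₀ (hr _).ne', mul_one]
  let φ : C(UnitAddCircle, UnitAddCircle) :=
    ⟨hper.lift, continuous_coinduced_dom.mpr ((AddCircle.continuous_mk' (1 : ℝ)).comp hσc)⟩
  have hφ : ∀ t : ℝ, φ (t : UnitAddCircle) = (σ t : UnitAddCircle) := hper.lift_coe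
  refine ⟨φ, by rw [hφ, hσ0], ?_, fun Y => ?_⟩
  · intro Y Y' h t
    simp only [ContinuousMap.comp_apply, hφ]
    exact hderiv Y Y' h t
  · rw [mean_eq]
    simp only [ContinuousMap.comp_apply, hφ]
    have hH : ∀ t : ℝ, HasDerivAt
        (fun t : ℝ => ∫ s in (0 : ℝ)..σ t, (Y * r) (s : UnitAddCircle))
        (Y (σ t : UnitAddCircle)) t := by
      intro t
      refine ((hasDerivAt_integral (Y * r) (σ t)).comp t (hσd t)).congr_deriv ?_
      rw [ContinuousMap.mul_apply, mul_assoc, mul_inv_cancel₀ (hr _).ne', mul_one]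
    rw [intervalIntegral.integral_eq_sub_of_hasDerivAt (fun s _ => hH s)
      ((Y.continuous_coe.comp hσc).intervalIntegrable _ _)]
    have h1 : σ 1 = n := by rw [← zero_add (1 : ℝ), hσp, hσ0, zero_add]
    rw [h1, hσ0, integral_nat, intervalIntegral.integral_same, sub_zero]

/-! ### A positive density on a large oscillation -/

/-- The functional `ρ ↦ ∫ k ρ`. -/
noncomputable def meanMul (k : C0) : C0 →L[ℝ] ℝ := mean.comp (ContinuousLinearMap.mul ℝ C0 k)

lemma meanMul_apply (k ρ : C0) : meanMul k ρ = mean (k * ρ) := rfl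

lemma exists_combination_of_ker {k₁ k₂ : C0} {Λ : C0 →ₗ[ℝ] ℝ}
    (h : ∀ ρ, mean (k₁ * ρ) = 0 → mean (k₂ * ρ) = 0 → Λ ρ = 0) :
    ∃ a b : ℝ, ∀ ρ, Λ ρ = mean ((a • k₁ + b • k₂) * ρ) := by
  have hle : ⨅ i, LinearMap.ker (![(meanMul k₁).toLinearMap, (meanMul k₂).toLinearMap] i)
      ≤ LinearMap.ker Λ := by
    intro ρ hρ
    rw [Submodule.mem_iInf] at hρ
    exact h ρ (hρ 0) (hρ 1)
  have hmem := mem_span_of_iInf_ker_le_ker hle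
  rw [Submodule.mem_span_range_iff_exists_fun] at hmem
  obtain ⟨c, hc⟩ := hmem
  refine ⟨c 0, c 1, fun ρ => ?_⟩
  rw [← hc, add_mul, map_add, smul_mul_assoc, smul_mul_assoc, map_smul, map_smul]
  simp [Fin.sum_univ_two, meanMul_apply]

lemma isOpen_pos : IsOpen {ρ : C0 | ∀ s, 0 < ρ s} := by
  have h := ContinuousMap.isOpen_setOfPred_mapsTo (X := UnitAddCircle) (Y := ℝ) isCompact_univ
    (isOpen_Ioi (a := 0))
  convert! h using 2
  ext ρ
  simp [MapsTo]

lemma convex_pos : Convex ℝ {ρ : C0 | ∀ s, 0 < ρ s} := by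
  intro ρ hρ ρ' hρ' a b ha hb hab s
  simp only [ContinuousMap.add_apply, ContinuousMap.smul_apply, smul_eq_mul]
  rcases ha.eq_or_lt with rfl | ha
  · rw [zero_add] at hab
    subst hab
    simpa using hρ' s
  · exact add_pos_of_pos_of_nonneg (mul_pos ha (hρ s)) (mul_nonneg hb (hρ' s).le)

/-- The positive part of `k`, plus a constant small enough not to spoil the sign. -/
lemma exists_pos_mean_mul_nonneg {k : C0} {s : UnitAddCircle} (hs : 0 < k s) :
    ∃ ρ : C0, (∀ s, 0 < ρ s) ∧ 0 ≤ mean (k * ρ) := by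
  set p : C0 := ⟨fun s => max (k s) 0, k.continuous.max continuous_const⟩ with hp
  have hA : 0 < mean (k * p) := by
    refine mean_pos_of_nonneg (s := s) (fun s => ?_) ?_
    · simp only [hp, ContinuousMap.mul_apply, ContinuousMap.coe_mk]
      rcases le_total (k s) 0 with h | h
      · rw [max_eq_right h, mul_zero]
      · rw [max_eq_left h]
        exact mul_self_nonneg _
    · simp only [hp, ContinuousMap.mul_apply, ContinuousMap.coe_mk]
      rw [max_eq_left hs.le]
      exact (mul_pos hs hs).ne'
  set ε := mean (k * p) / (|mean k| + 1) with hε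
  have hε0 : 0 < ε := by positivity
  refine ⟨p + ε • 1, fun s => ?_, ?_⟩
  · have : 0 ≤ p s := le_max_right _ _
    simp only [ContinuousMap.add_apply, ContinuousMap.smul_apply, ContinuousMap.one_apply,
      smul_eq_mul, mul_one]
    linarith
  · rw [mul_add, map_add, mul_smul_comm, map_smul, mul_one, smul_eq_mul]
    have h1 : ε * |mean k| ≤ mean (k * p) := by
      rw [hε, div_mul_eq_mul_div, div_le_iff₀ (by positivity)]
      nlinarith [abs_nonneg (mean k)]
    have h2 : -(ε * |mean k|) ≤ ε * mean k := by
      rw [← mul_neg]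
      exact mul_le_mul_of_nonneg_left (neg_abs_le _) hε0.le
    linarith

/-- If no nontrivial combination of `k₁`, `k₂` is nonpositive and `k₃` is no combination of
`k₁`, `k₂`, there is a positive density orthogonal to `k₁`, `k₂` but not to `k₃`. -/
lemma exists_density {k₁ k₂ k₃ : C0}
    (h12 : ∀ a b : ℝ, (a ≠ 0 ∨ b ≠ 0) → ∃ s, 0 < (a • k₁ + b • k₂) s)
    (h3 : ∀ a b : ℝ, k₃ ≠ a • k₁ + b • k₂) :
    ∃ ρ : C0, (∀ s, 0 < ρ s) ∧ mean (k₁ * ρ) = 0 ∧ mean (k₂ * ρ) = 0 ∧ mean (k₃ * ρ) ≠ 0 := by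
  have hex : ∃ ρ : C0, (∀ s, 0 < ρ s) ∧ mean (k₁ * ρ) = 0 ∧ mean (k₂ * ρ) = 0 := by
    by_contra! hc
    -- If the open convex cone of positive densities missed `N`, a separating functional would
    -- vanish on `N`. It would thus be integration against some `a k₁ + b k₂`, and negative on every
    -- positive density, although this combination is positive somewhere.
    set N : Submodule ℝ C0 :=
      LinearMap.ker (meanMul k₁).toLinearMap ⊓ LinearMap.ker (meanMul k₂).toLinearMap with hN
    have hdisj : Disjoint {ρ : C0 | ∀ s, 0 < ρ s} (N : Set C0) :=
      Set.disjoint_left.mpr fun ρ hρ hρN => hc ρ hρ hρN.1 hρN.2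
    obtain ⟨Λ, c, hΛ, hΛN⟩ := geometric_hahn_banach_open convex_pos isOpen_pos N.convex hdisj
    have hc0 : c ≤ 0 := by simpa using hΛN 0 N.zero_mem
    have hzero : ∀ ρ ∈ N, Λ ρ = 0 := by
      intro ρ hρ
      by_contra hne
      have := hΛN _ (N.smul_mem ((c - 1) / Λ ρ) hρ)
      rw [map_smul, smul_eq_mul, div_mul_cancel₀ _ hne] at this
      linarith
    obtain ⟨a, b, hab⟩ := exists_combination_of_ker (k₁ := k₁) (k₂ := k₂) (Λ := Λ.toLinearMap)
      fun ρ h1 h2 => hzero ρ ⟨h1, h2⟩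
    have hneg : ∀ ρ : C0, (∀ s, 0 < ρ s) → mean ((a • k₁ + b • k₂) * ρ) < 0 := fun ρ hρ => by
      rw [← hab]
      exact (hΛ ρ hρ).trans_le hc0
    have hne : a ≠ 0 ∨ b ≠ 0 := by
      by_contra! h0
      have := hneg 1 fun s => zero_lt_one
      simp [h0.1, h0.2] at this
    obtain ⟨s, hs⟩ := h12 a b hne
    obtain ⟨ρ, hρ, hρm⟩ := exists_pos_mean_mul_nonneg hs
    exact absurd (hneg ρ hρ) hρm.not_gt
  obtain ⟨ρ, hρ, h1, h2⟩ := hex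
  by_cases hz : mean (k₃ * ρ) = 0
  swap
  · exact ⟨ρ, hρ, h1, h2, hz⟩
  -- A small multiple of `η` corrects a density that is orthogonal to `k₃` as well. Without such an
  -- `η`, integration against `k₃` would agree with integration against a combination of `k₁`, `k₂`,
  -- forcing equality.
  obtain ⟨η, e1, e2, e3⟩ : ∃ η : C0, mean (k₁ * η) = 0 ∧ mean (k₂ * η) = 0 ∧
      mean (k₃ * η) ≠ 0 := by
    by_contra! hc
    obtain ⟨a, b, hab⟩ := exists_combination_of_ker (Λ := (meanMul k₃).toLinearMap) hc
    have hsq : mean ((k₃ - (a • k₁ + b • k₂)) * (k₃ - (a • k₁ + b • k₂))) = 0 := by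
      rw [sub_mul, map_sub, sub_eq_zero]
      exact hab _
    refine h3 a b (sub_eq_zero.mp ?_)
    ext s
    by_contra hne
    exact (mean_pos_of_nonneg (s := s) (fun s => mul_self_nonneg _)
      (mul_ne_zero hne hne)).ne' hsq
  have hcont : Continuous fun ε : ℝ => ρ + ε • η := by fun_prop
  have hev : ∀ᶠ ε : ℝ in 𝓝[>] 0, ρ + ε • η ∈ {ρ : C0 | ∀ s, 0 < ρ s} :=
    ((hcont.tendsto 0).eventually_mem (isOpen_pos.mem_nhds (by simpa using hρ))).filter_mono
      nhdsWithin_le_nhds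
  obtain ⟨ε, hε, hε0⟩ := (hev.and self_mem_nhdsWithin).exists
  refine ⟨ρ + ε • η, hε, ?_, ?_, ?_⟩ <;>
    rw [mul_add, map_add, mul_smul_comm, map_smul, smul_eq_mul]
  · rw [h1, e1]; simp
  · rw [h2, e2]; simp
  · rw [hz, zero_add]
    exact mul_ne_zero (ne_of_gt hε0) e3

/-! ### Construction of a cusp -/

lemma abs_mean_le (u : C0) : |mean u| ≤ ‖u‖ := by
  rw [mean_eq]
  exact abs_integral_le_norm u ⟨zero_le_one, le_rfl⟩

/-- The speed is `r = ρ / (C - G)`. Its average is continuous in `C` and small for large `C`, so it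
takes some value `1 / n` with `C` beyond any prescribed bound; large `C` also avoids the one value
with `C z = J`. -/
lemma exists_scaling {ρ : C0} (hρ : ∀ s, 0 < ρ s) (G : C0) {z : ℝ} (hz : z ≠ 0) (J : ℝ) :
    ∃ (C : ℝ) (n : ℕ) (r : C0), 0 < C ∧ (∀ s, 0 < r s) ∧ (∀ s, r s * (C - G s) = ρ s) ∧
      mean r * n = 1 ∧ C * z ≠ J := by
  -- Truncation at `1` makes the speed continuous in every `C`; it is inactive once `C ≥ ‖G‖ + 1`.
  let h : C(ℝ, ℝ) := ⟨fun x => (max x 1)⁻¹, (continuous_id.max continuous_const).inv₀ fun x =>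
    (lt_max_of_lt_right zero_lt_one).ne'⟩
  set R : ℝ → C0 := fun C => ρ * h.comp (ContinuousMap.const _ C + -G) with hR
  have hRc : Continuous R := continuous_const.mul
    ((ContinuousMap.continuous_postcomp h).comp (contDiff_const_map (-G)).continuous)
  have hRpos : ∀ C s, 0 < R C s := fun C s =>
    mul_pos (hρ s) (inv_pos.mpr (lt_max_of_lt_right zero_lt_one))
  have hge : ∀ C, ‖G‖ + 1 ≤ C → ∀ s, 1 ≤ C - G s := fun C hC s => by
    linarith [le_of_abs_le (G.abs_le s)]
  have hRval : ∀ C, ‖G‖ + 1 ≤ C → ∀ s, R C s = ρ s * (C - G s)⁻¹ := fun C hC s => by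
    change ρ s * (max (C + -G s) 1)⁻¹ = _
    rw [← sub_eq_add_neg, max_eq_left (hge C hC s)]
  set C₁ := ‖G‖ + 1 + |J / z| with hC₁
  have hτ₁ : 0 < mean (R C₁) := mean_pos_of_nonneg (fun s => (hRpos _ s).le) (hRpos C₁ 0).ne'
  obtain ⟨n, hn⟩ := exists_nat_one_div_lt hτ₁
  set C₂ := C₁ + ‖ρ‖ * (n + 1) with hC₂
  have h12 : C₁ ≤ C₂ := le_add_of_nonneg_right (by positivity)
  have hG₁ : ‖G‖ + 1 ≤ C₁ := le_add_of_nonneg_right (abs_nonneg _)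
  have hτ₂ : mean (R C₂) ≤ 1 / ((n : ℝ) + 1) := by
    refine (le_abs_self _).trans ((abs_mean_le _).trans ?_)
    rw [ContinuousMap.norm_le _ (by positivity)]
    intro s
    rw [Real.norm_of_nonneg (hRpos _ s).le, hRval _ (hG₁.trans h12), ← div_eq_mul_inv,
      div_le_div_iff₀ (by linarith [hge _ (hG₁.trans h12) s]) (by positivity), one_mul]
    have h1 : ρ s * (n + 1) ≤ ‖ρ‖ * (n + 1) :=
      mul_le_mul_of_nonneg_right (le_of_abs_le (ρ.abs_le s)) (by positivity)
    linarith [le_of_abs_le (G.abs_le s), abs_nonneg (J / z)]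
  obtain ⟨C, hC, hCn⟩ := intermediate_value_Icc' h12
    (mean.continuous.comp hRc).continuousOn ⟨hτ₂, hn.le⟩
  have hCG := hG₁.trans hC.1
  refine ⟨C, n + 1, R C, by linarith [norm_nonneg G], hRpos C, fun s => ?_, ?_, fun h => ?_⟩
  · rw [hRval C hCG, inv_mul_cancel_right₀ (by linarith [hge C hCG s])]
  · simp only [Function.comp_apply] at hCn
    rw [hCn]
    push_cast
    field_simp
  · have h1 : C = J / z := by rw [← h, mul_div_cancel_right₀ _ hz]
    have h2 := le_abs_self (J / z)
    linarith [norm_nonneg G, hC.1]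

lemma exists_oscillation {M : ℝ} (hM : 0 < M) :
    ∃ U U' : C0, (∀ t : ℝ, HasDerivAt (fun t : ℝ => U (t : UnitAddCircle)) (U' t) t) ∧
      ∀ x ∈ Icc (-M) M, ∃ s, U s = x := by
  have hp : Function.Periodic (fun t : ℝ => M * Real.cos (2 * Real.pi * t)) 1 := fun t => by
    simp only
    rw [mul_add, mul_one, Real.cos_add_two_pi]
  have hp' : Function.Periodic
      (fun t : ℝ => M * (-Real.sin (2 * Real.pi * t) * (2 * Real.pi))) 1 := fun t => by
    simp only
    rw [mul_add, mul_one, Real.sin_add_two_pi]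
  refine ⟨ofPeriodic _ (by fun_prop) hp, ofPeriodic _ (by fun_prop) hp', fun t => ?_,
    fun x hx => ?_⟩
  · simp_rw [ofPeriodic_coe]
    have h := ((hasDerivAt_id t).const_mul (2 * Real.pi)).cos.const_mul M
    simpa using h
  · refine ⟨((Real.arccos (x / M) / (2 * Real.pi) : ℝ) : UnitAddCircle), ?_⟩
    rw [ofPeriodic_coe, mul_div_cancel₀ _ (by positivity), Real.cos_arccos, mul_div_cancel₀ _ hM.ne']
    · rw [le_div_iff₀ hM]; linarith [hx.1]
    · rw [div_le_iff₀ hM]; linarith [hx.2]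

/-- With `W = C - prim (k₁ ρ)` and time running as `dt = r ds`, `r = ρ / W`, the equation `W' = -k₁
ρ` becomes `w' = -f'(u) w`. Averages of `f'(u) w` and `f''(u) w` become multiples of those of `k₁ ρ`
and `k₂ ρ`, hence vanish. That of `f'''(u) w²` becomes a nonzero multiple of `C mean (k₃ ρ) - mean
(k₃ ρ G)`, which the choice of `C` keeps nonzero. -/
lemma exists_cusp_data {f : C(ℝ, ℝ)} (hf : ContDiff ℝ ∞ f) (h3 : IsGood 3 f)
    (h : (0 : Fin 2 → ℝ) ∈ interior (convexHull ℝ (range (gammaHat 2 f)))) :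
    ∃ (u₀ w₀ k : C0) (c : ℝ), u₀ = ContinuousMap.const _ c + prim k ∧
      w₀ + prim ((derivMap f hf).comp u₀ * w₀) = 1 ∧
      mean ((derivMap f hf).comp u₀ * w₀) = 0 ∧
      mean ((derivMap₂ hf).comp u₀ * w₀) = 0 ∧
      mean ((derivMap₃ hf).comp u₀ * w₀ * w₀) ≠ 0 := by
  obtain ⟨M, hM, hneg⟩ := exists_bounded_neg_functional h
  obtain ⟨U, U', hU, hUsurj⟩ := exists_oscillation hM
  set k₁ : C0 := (derivMap f hf).comp U with hk₁
  set k₂ : C0 := (derivMap₂ hf).comp U with hk₂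
  set k₃ : C0 := (derivMap₃ hf).comp U with hk₃
  obtain ⟨ρ, hρ, e1, e2, e3⟩ := exists_density (k₁ := k₁) (k₂ := k₂) (k₃ := k₃)
    (by
      intro a b hab
      have hl : coeffFunctional ![-a, -b] ≠ 0 := by
        rcases hab with ha | hb
        · exact coeffFunctional_ne_zero (i := 0) (by simpa using ha)
        · exact coeffFunctional_ne_zero (i := 1) (by simpa using hb)
      obtain ⟨x, hx, hxl⟩ := hneg _ hl
      obtain ⟨s, rfl⟩ := hUsurj x hx
      refine ⟨s, ?_⟩
      rw [coeffFunctional_apply, Fin.sum_univ_two, gammaHat_zero hf 1, gammaHat_one hf 0] at hxl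
      simp only [Matrix.cons_val_zero, Matrix.cons_val_one] at hxl
      simp only [hk₁, hk₂, ContinuousMap.add_apply, ContinuousMap.smul_apply,
        ContinuousMap.comp_apply, smul_eq_mul]
      linarith)
    (by
      intro a b hab
      obtain ⟨x, hx, hne⟩ := IsGood.three_exists_ne hf h3 (a := -a) (b := -b) (c := 1) one_ne_zero
        (show -M < M by linarith)
      obtain ⟨s, rfl⟩ := hUsurj x (Ioo_subset_Icc_self hx)
      have := congrArg (fun g : C0 => g s) hab
      simp only [hk₁, hk₂, hk₃, ContinuousMap.add_apply, ContinuousMap.smul_apply,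
        ContinuousMap.comp_apply, smul_eq_mul] at this
      refine hne ?_
      linarith)
  set G : C0 := prim (k₁ * ρ) with hG
  obtain ⟨C, n, r, hC, hr, hrG, hrn, hCz⟩ := exists_scaling hρ G e3 (mean (k₃ * ρ * G))
  obtain ⟨φ, hφ0, hφd, hφm⟩ := exists_reparametrization hr hrn
  set W : C0 := ContinuousMap.const _ C - G with hW
  have hrW : W * r = ρ := by
    ext s
    rw [ContinuousMap.mul_apply, mul_comm]
    exact hrG s
  have hn : (n : ℝ) ≠ 0 := fun h0 => by simp [h0] at hrn
  let rinv : C0 := ⟨fun s => (r s)⁻¹, r.continuous.inv₀ fun s => (hr s).ne'⟩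
  have hu := eq_const_add_prim (hφd U (U' * rinv) fun t => by
    refine (hU t).congr_deriv ?_
    change _ = U' (t : UnitAddCircle) * (r (t : UnitAddCircle))⁻¹ * r (t : UnitAddCircle)
    rw [inv_mul_cancel_right₀ (hr _).ne'])
  have hwd := hφd (C⁻¹ • W) (-(k₁ * (C⁻¹ • W))) fun t => by
    have hWd : HasDerivAt (fun t : ℝ => W (t : UnitAddCircle))
        (-(k₁ * ρ) (t : UnitAddCircle)) t := by
      have := (hasDerivAt_prim (k₁ * ρ) t).const_sub C
      rwa [e1, sub_zero] at this
    refine (hWd.const_mul C⁻¹).congr_deriv ?_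
    rw [← hrW]
    simp only [ContinuousMap.mul_apply, ContinuousMap.neg_apply, ContinuousMap.smul_apply,
      smul_eq_mul]
    ring
  have hw := eq_const_add_prim hwd
  set u₀ : C0 := U.comp φ with hu₀
  set w₀ : C0 := (C⁻¹ • W).comp φ with hw₀
  have hw0 : w₀ ((0 : ℝ) : UnitAddCircle) = 1 := by
    change C⁻¹ * (C - G (φ ((0 : ℝ) : UnitAddCircle))) = 1
    rw [hφ0, hG, prim_zero, sub_zero, inv_mul_cancel₀ hC.ne']
  have hmul : (-(k₁ * (C⁻¹ • W)) : C0).comp φ = -((derivMap f hf).comp u₀ * w₀) := rfl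
  rw [hmul, hw0, map_neg, map_neg, neg_eq_zero] at hw
  refine ⟨u₀, w₀, (U' * rinv).comp φ, _, hu.1, ?_, hw.2, ?_, ?_⟩
  · conv_lhs => enter [1]; rw [hw.1]
    rw [neg_add_cancel_right]
    rfl
  · have : (derivMap₂ hf).comp u₀ * w₀ = (k₂ * (C⁻¹ • W)).comp φ := rfl
    rw [this, hφm, mul_smul_comm, smul_mul_assoc, mul_assoc, hrW, map_smul, e2, smul_zero,
      mul_zero]
  · have : (derivMap₃ hf).comp u₀ * w₀ * w₀ = (k₃ * (C⁻¹ • W) * (C⁻¹ • W)).comp φ := rfl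
    have h5 : k₃ * (C⁻¹ • W) * (C⁻¹ • W) * r = (C⁻¹ * C⁻¹) • (C • (k₃ * ρ) - k₃ * ρ * G) := by
      rw [← hrW]
      ext s
      simp only [hW, ContinuousMap.mul_apply, ContinuousMap.smul_apply, ContinuousMap.sub_apply,
        ContinuousMap.const_apply, smul_eq_mul]
      ring
    rw [this, hφm, h5, map_smul, map_sub, map_smul, smul_eq_mul, smul_eq_mul]
    exact mul_ne_zero hn (mul_ne_zero (by positivity) (sub_ne_zero.mpr hCz))

/-! ### The operator in terms of initial value and derivative -/

/-- A pair of Banach spaces `E`, `B` of functions and of derivatives on the circle: elements of `E`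
are determined by their value at `0` and by their derivative, an element of `B` of average zero. -/
structure CircleModel (E B : Type) [NormedAddCommGroup E] [NormedSpace ℝ E]
    [NormedAddCommGroup B] [NormedSpace ℝ B] where
  /-- The inclusion of continuous functions. -/
  incl : C0 →L[ℝ] B
  /-- The average. -/
  avg : B →L[ℝ] ℝ
  /-- The primitive, vanishing at `0`, of an element minus its average. -/
  primitive : B →L[ℝ] C0
  avg_incl : ∀ h, avg (incl h) = mean h
  primitive_incl : ∀ h, primitive (incl h) = prim h
  /-- The subspace of elements of average zero. -/
  tilde : Submodule ℝ B
  mem_tilde : ∀ v, v ∈ tilde ↔ avg v = 0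
  /-- Value at `0` and derivative. -/
  coord : E ≃L[ℝ] ℝ × tilde

namespace CircleModel

variable {E B : Type} [NormedAddCommGroup E] [NormedSpace ℝ E]
    [NormedAddCommGroup B] [NormedSpace ℝ B] (𝓜 : CircleModel E B)

/-- The constant function `1` as an element of `B`. -/
noncomputable def one : B := 𝓜.incl 1

lemma avg_one : 𝓜.avg 𝓜.one = 1 := by rw [one, avg_incl, mean_one]

lemma primitive_one : 𝓜.primitive 𝓜.one = 0 := by rw [one, primitive_incl, prim_one]

/-- The projection onto the elements of average zero. -/
noncomputable def proj : B →L[ℝ] 𝓜.tilde :=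
  (ContinuousLinearMap.id ℝ B - 𝓜.avg.smulRight 𝓜.one).codRestrict 𝓜.tilde fun v => by
    rw [mem_tilde]
    simp [avg_one]

lemma coe_proj (v : B) : (𝓜.proj v : B) = v - 𝓜.avg v • 𝓜.one := rfl

lemma primitive_proj_incl (h : C0) : 𝓜.primitive (𝓜.proj (𝓜.incl h)) = prim h := by
  rw [coe_proj, map_sub, map_smul, primitive_one, smul_zero, sub_zero, primitive_incl]

/-- An element of `B` is the sum of its average and of an element of average zero. -/
noncomputable def split : B ≃L[ℝ] ℝ × 𝓜.tilde :=
  ContinuousLinearEquiv.equivOfInverse (𝓜.avg.prod 𝓜.proj)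
    (((ContinuousLinearMap.fst ℝ ℝ 𝓜.tilde).smulRight 𝓜.one) +
      𝓜.tilde.subtypeL.comp (ContinuousLinearMap.snd ℝ ℝ 𝓜.tilde))
    (fun v => by simp [coe_proj])
    (fun p => by
      have h : 𝓜.avg (p.2 : B) = 0 := (𝓜.mem_tilde _).mp p.2.2
      ext
      · simp [avg_one, h]
      · simp [coe_proj, avg_one, h])

lemma split_apply (v : B) : 𝓜.split v = (𝓜.avg v, 𝓜.proj v) := rfl

/-- The function with given value at `0` and given derivative. -/
noncomputable def fn : ℝ × 𝓜.tilde →L[ℝ] C0 :=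
  (ContinuousLinearMap.fst ℝ ℝ 𝓜.tilde).smulRight (1 : C0) +
    𝓜.primitive.comp (𝓜.tilde.subtypeL.comp (ContinuousLinearMap.snd ℝ ℝ 𝓜.tilde))

lemma fn_apply (p : ℝ × 𝓜.tilde) :
    𝓜.fn p = ContinuousMap.const _ p.1 + 𝓜.primitive p.2 := by
  ext s
  simp [fn]

/-- The operator `u ↦ u' + f ∘ u`. -/
noncomputable def op (f : C(ℝ, ℝ)) (u : E) : B :=
  (𝓜.coord u).2 + 𝓜.incl (f.comp (𝓜.fn (𝓜.coord u)))

variable {f : C(ℝ, ℝ)} {S : C0 → C0}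

/-- The primitive ignores averages, so fixing the initial value and the projection of `u' + f ∘ u`
is the same as fixing `addPrim f u`. -/
lemma fn_add_proj (p : ℝ × 𝓜.tilde) :
    𝓜.fn (p.1, p.2 + 𝓜.proj (𝓜.incl (f.comp (𝓜.fn p)))) = addPrim f (𝓜.fn p) := by
  rw [addPrim, fn_apply, fn_apply, Submodule.coe_add, map_add, primitive_proj_incl, add_assoc]

/-- The map sending the initial value and derivative of `u` to its initial value and to the
projection of `u' + f ∘ u`. -/
noncomputable def straighten (h₁ : ∀ g, addPrim f (S g) = g) (h₂ : ∀ u, S (addPrim f u) = u) :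
    ℝ × 𝓜.tilde ≃ ℝ × 𝓜.tilde where
  toFun p := (p.1, p.2 + 𝓜.proj (𝓜.incl (f.comp (𝓜.fn p))))
  invFun p := (p.1, p.2 - 𝓜.proj (𝓜.incl (f.comp (S (𝓜.fn p)))))
  left_inv p := by
    simp only [fn_add_proj, h₂]
    simp
  right_inv p := by
    have : 𝓜.fn (p.1, p.2 - 𝓜.proj (𝓜.incl (f.comp (S (𝓜.fn p))))) = S (𝓜.fn p) := by
      rw [fn_apply]
      simp only
      rw [Submodule.coe_sub, map_sub, primitive_proj_incl, ← add_sub_assoc, ← 𝓜.fn_apply p]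
      exact sub_eq_iff_eq_add.mpr (h₁ (𝓜.fn p)).symm
    simp only [this]
    simp

section Straighten

variable (hf : ContDiff ℝ ∞ f) (hS : ContDiff ℝ ∞ S)
  (h₁ : ∀ g, addPrim f (S g) = g) (h₂ : ∀ u, S (addPrim f u) = u)

include hf in
lemma contDiff_straighten : ContDiff ℝ ∞ (𝓜.straighten h₁ h₂) :=
  contDiff_fst.prodMk (contDiff_snd.add (𝓜.proj.contDiff.comp (𝓜.incl.contDiff.comp
    ((contDiff_comp hf).comp 𝓜.fn.contDiff))))

include hf hS in
lemma contDiff_straighten_symm : ContDiff ℝ ∞ (𝓜.straighten h₁ h₂).symm :=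
  contDiff_fst.prodMk (contDiff_snd.sub (𝓜.proj.contDiff.comp (𝓜.incl.contDiff.comp
    ((contDiff_comp hf).comp (hS.comp 𝓜.fn.contDiff)))))

/-- The average of `u' + f ∘ u` as a function of the initial value and of the projection of
`u' + f ∘ u`. -/
noncomputable def height (f : C(ℝ, ℝ)) (S : C0 → C0) (q : ℝ × 𝓜.tilde) : ℝ :=
  mean (f.comp (S (𝓜.fn q)))

include hf hS in
lemma contDiff_height : ContDiff ℝ ∞ (𝓜.height f S) :=
  mean.contDiff.comp ((contDiff_comp hf).comp (hS.comp 𝓜.fn.contDiff))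

/-- The adapted form of the operator: only its average, as a function of the initial value, remains
to be studied. -/
lemma split_op (q : ℝ × 𝓜.tilde) :
    𝓜.split (𝓜.op f (𝓜.coord.symm ((𝓜.straighten h₁ h₂).symm q))) = (𝓜.height f S q, q.2) := by
  set p := (𝓜.straighten h₁ h₂).symm q with hp
  have hq : 𝓜.straighten h₁ h₂ p = q := Equiv.apply_symm_apply _ _
  have hfn : 𝓜.fn p = S (𝓜.fn q) := by
    rw [← hq]
    exact (h₂ _).symm.trans (congrArg S (𝓜.fn_add_proj p).symm)
  have h : 𝓜.avg (p.2 : B) = 0 := (𝓜.mem_tilde _).mp p.2.2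
  rw [split_apply, op, ContinuousLinearEquiv.apply_symm_apply]
  refine Prod.ext ?_ ?_
  · simp only
    rw [map_add, h, zero_add, avg_incl, hfn, height]
  · rw [← hq]
    change _ = p.2 + 𝓜.proj (𝓜.incl (f.comp (𝓜.fn p)))
    rw [map_add]
    ext
    simp [coe_proj, h]

lemma height_apply (y : ℝ) (v : 𝓜.tilde) :
    𝓜.height f S (y, v) = mean (f.comp (S (ContinuousMap.const _ y + 𝓜.primitive v))) := by
  rw [height, fn_apply]

include hf hS in
lemma partialFst_height (y : ℝ) (v : 𝓜.tilde) : partialFst (𝓜.height f S) (y, v)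
    = deriv (fun y => mean (f.comp (S (ContinuousMap.const _ y + 𝓜.primitive v)))) y := by
  simp_rw [← height_apply]
  exact (hasDerivAt_partialFst (𝓜.contDiff_height hf hS) y v).deriv.symm

include hf hS in
lemma partialFst_partialFst_height (y : ℝ) (v : 𝓜.tilde) :
    partialFst (partialFst (𝓜.height f S)) (y, v)
    = deriv (deriv fun y => mean (f.comp (S (ContinuousMap.const _ y + 𝓜.primitive v)))) y := by
  rw [← (hasDerivAt_partialFst (contDiff_partialFst (𝓜.contDiff_height hf hS)) y v).deriv]
  simp_rw [𝓜.partialFst_height hf hS]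

end Straighten

/-! ### Fold and cusp in an abstract model -/

lemma contDiff_line {S : C0 → C0} (hS : ContDiff ℝ ∞ S) (g : C0) :
    ContDiff ℝ ∞ fun y : ℝ => S (ContinuousMap.const _ y + g) :=
  hS.comp (contDiff_const_map g)

lemma deriv_line_eq {S : C0 → C0} (hS : ContDiff ℝ ∞ S) (g : C0) (y : ℝ) :
    deriv (fun y : ℝ => S (ContinuousMap.const _ y + g)) y
      = fderiv ℝ S (ContinuousMap.const _ y + g) 1 :=
  (((hS.differentiable (by simp)) _).hasFDerivAt.comp_hasDerivAt y
    (hasDerivAt_const_map g y)).deriv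

/-- On every vertical line `height` is proper with only nondegenerate minima, so it is `x ^ 2 + β v`
after a change of the line variable; subtracting `β v` in the target leaves the fold. -/
theorem isGlobalFold [CompleteSpace 𝓜.tilde] (hf : ContDiff ℝ ∞ f)
    (h2 : IsGood 2 f) (hlim : Tendsto f (cocompact ℝ) atTop)
    (h : (0 : Fin 2 → ℝ) ∉ interior (convexHull ℝ (range (gammaHat 2 f)))) :
    IsGlobalFold 𝓜.tilde (𝓜.op f) := by
  obtain ⟨S, hS, h₁, h₂⟩ := exists_solution hlim hf
  obtain ⟨a, b, hb, hab⟩ := exists_nonneg_combination hf h2 hlim h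
  have hh := 𝓜.contDiff_height hf hS
  obtain ⟨Θ, β, hΘ, hΘ', hβ, hΘl⟩ := exists_fold_normal_form hh
    (fun v => by
      simp_rw [height_apply]
      exact tendsto_mean_comp hlim h₁ _)
    (by
      rintro ⟨y, v⟩ hy
      rw [𝓜.partialFst_height hf hS] at hy
      rw [𝓜.partialFst_partialFst_height hf hS]
      have hu := contDiff_line hS (𝓜.primitive v)
      have hg := fun y => h₁ (ContinuousMap.const _ y + 𝓜.primitive v)
      have hI := integral_expInt_pos
        ((derivMap f hf).comp (S (ContinuousMap.const _ y + 𝓜.primitive v)))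
      have e1 := deriv_mean_mul hf hu hg y
      rw [hy, zero_mul] at e1
      have hm : mean ((derivMap f hf).comp (S (ContinuousMap.const _ y + 𝓜.primitive v))) = 0 := by
        rw [← Real.exp_eq_one_iff]; linarith
      have hw := deriv_line hf hu hg y
      have e2 := deriv_mean_two_mul hf hu hg hy
      rw [deriv_mean hf hu] at hy
      have hpos := mean_deriv_two_pos hf h2 hb hab (fun s => by
        obtain ⟨t, -, rfl⟩ := exists_mem_Ico_coe s
        have := mul_expInt_eq_one hw hy (t := t)
        exact pos_of_mul_pos_left (this ▸ zero_lt_one) (expInt_pos _ _).le) hm hy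
      rw [← e2] at hpos
      exact pos_of_mul_pos_left hpos hI.le)
  let Ψ := 𝓜.straighten h₁ h₂
  let e : ℝ × 𝓜.tilde ≃ ℝ × 𝓜.tilde :=
    { toFun := fun p => (p.1 - β p.2, p.2)
      invFun := fun p => (p.1 + β p.2, p.2)
      left_inv := fun p => by simp
      right_inv := fun p => by simp }
  refine ⟨𝓜.coord.toEquiv.trans (Ψ.trans Θ), 𝓜.split.toEquiv.trans e,
    hΘ.comp ((𝓜.contDiff_straighten hf h₁ h₂).comp 𝓜.coord.contDiff),
    𝓜.coord.symm.contDiff.comp ((𝓜.contDiff_straighten_symm hf hS h₁ h₂).comp hΘ'),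
    ((contDiff_fst.sub (hβ.comp contDiff_snd)).prodMk contDiff_snd).comp 𝓜.split.contDiff,
    𝓜.split.symm.contDiff.comp ((contDiff_fst.add (hβ.comp contDiff_snd)).prodMk contDiff_snd),
    fun x v => ?_⟩
  change e (𝓜.split (𝓜.op f (𝓜.coord.symm (Ψ.symm (Θ.symm (x, v)))))) = _
  rw [𝓜.split_op h₁ h₂]
  obtain ⟨h3, h4⟩ := hΘl (Θ.symm (x, v))
  rw [Equiv.apply_symm_apply] at h3 h4
  simp only at h3 h4
  change (𝓜.height f S _ - β (Θ.symm (x, v)).2, (Θ.symm (x, v)).2) = _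
  rw [h3, ← h4, add_sub_cancel_right]

/-- The vertical derivative of the average has a nonzero differential at a singular point. -/
lemma exists_fderiv_partialFst_ne_zero (hf : ContDiff ℝ ∞ f) (h2 : IsGood 2 f)
    (hS : ContDiff ℝ ∞ S) (h₁ : ∀ g, addPrim f (S g) = g) {q₀ : ℝ × 𝓜.tilde} {c : ℝ} {k : C0}
    (hu₀ : S (𝓜.fn q₀) = ContinuousMap.const _ c + prim k)
    (hm : mean ((derivMap f hf).comp (S (𝓜.fn q₀))) = 0)
    (h0 : partialFst (𝓜.height f S) q₀ = 0) :
    ∃ d, fderiv ℝ (partialFst (𝓜.height f S)) q₀ d ≠ 0 := by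
  set u₀ := S (𝓜.fn q₀) with hu₀'
  set η : C0 := (derivMap₂ hf).comp u₀ with hη
  have hW : ∀ q : ℝ × 𝓜.tilde, partialFst (𝓜.height f S) q
      = mean ((derivMap f hf).comp (S (𝓜.fn q)) * fderiv ℝ S (𝓜.fn q) 1) ∧
      fderiv ℝ S (𝓜.fn q) 1 +
        prim ((derivMap f hf).comp (S (𝓜.fn q)) * fderiv ℝ S (𝓜.fn q) 1) = 1 := by
    rintro ⟨y, v⟩
    have hu := contDiff_line hS (𝓜.primitive v)
    have hg := fun y => h₁ (ContinuousMap.const _ y + 𝓜.primitive v)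
    have e1 := deriv_mean hf hu y
    have e2 := deriv_line hf hu hg y
    rw [deriv_line_eq hS] at e1 e2
    rw [𝓜.partialFst_height hf hS, fn_apply]
    exact ⟨e1, e2⟩
  -- The direction `d` is chosen so that `u` moves with velocity `η = f''(u₀)`. It exists because
  -- `η` is continuously differentiable, which is why `u₀` is required to be a primitive.
  obtain ⟨d, hd⟩ : ∃ d, 𝓜.fn d = linOp ((derivMap f hf).comp u₀) η := by
    have hηd : ∀ t : ℝ, HasDerivAt (fun t : ℝ => η (t : UnitAddCircle))
        (((derivMap₃ hf).comp u₀ * (k - ContinuousMap.const _ (mean k)) : C0)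
          (t : UnitAddCircle)) t := by
      intro t
      have hut : HasDerivAt (fun t : ℝ => u₀ (t : UnitAddCircle))
          (k (t : UnitAddCircle) - mean k) t := by
        rw [hu₀]
        exact (hasDerivAt_prim k t).const_add c
      exact (hasDerivAt_derivMap (contDiff_derivMap (contDiff_derivMap hf)) _).comp t hut
    have hη2 := (eq_const_add_prim hηd).1
    refine ⟨(η ((0 : ℝ) : UnitAddCircle), 𝓜.proj (𝓜.incl
      ((derivMap₃ hf).comp u₀ * (k - ContinuousMap.const _ (mean k))
        + (derivMap f hf).comp u₀ * η))), ?_⟩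
    rw [fn_apply]
    simp only
    rw [primitive_proj_incl, map_add prim, ← add_assoc, ← hη2, linOp_apply]
  refine ⟨d, ?_⟩
  have hline : ∀ s : ℝ, 𝓜.fn (q₀ + s • d) = 𝓜.fn q₀ + s • 𝓜.fn d := fun s => by simp
  have hq : HasDerivAt (fun s : ℝ => q₀ + s • d) d 0 := by
    simpa using ((hasDerivAt_id (0 : ℝ)).smul_const d).const_add q₀
  have hfnq : HasDerivAt (fun s : ℝ => 𝓜.fn (q₀ + s • d)) (𝓜.fn d) 0 :=
    𝓜.fn.hasFDerivAt.comp_hasDerivAt 0 hq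
  have hU : HasDerivAt (fun s : ℝ => S (𝓜.fn (q₀ + s • d))) (fderiv ℝ S (𝓜.fn q₀) (𝓜.fn d)) 0 := by
    have := ((hS.differentiable (by simp)) (𝓜.fn (q₀ + (0 : ℝ) • d))).hasFDerivAt.comp_hasDerivAt 0
      hfnq
    rw [zero_smul, add_zero] at this
    exact this
  have hUη : fderiv ℝ S (𝓜.fn q₀) (𝓜.fn d) = η := by
    refine (linEquiv ((derivMap f hf).comp u₀)).injective ?_
    have e := hU.fun_add (hasDerivAt_clm_curve prim (hasDerivAt_comp_curve hf hU))
    have e' := e.unique (hfnq.congr_of_eventuallyEq (Eventually.of_forall fun s => h₁ _))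
    rw [zero_smul, add_zero] at e'
    rw [← ContinuousLinearEquiv.coe_coe, coe_linEquiv, ← hd]
    exact e'
  rw [hUη] at hU
  have hWs : ContDiff ℝ ∞ fun g => fderiv ℝ S g 1 :=
    (contDiff_infty_iff_fderiv.mp hS).2.clm_apply contDiff_const
  obtain ⟨ζ, hζ⟩ : ∃ ζ, HasDerivAt (fun s : ℝ => fderiv ℝ S (𝓜.fn (q₀ + s • d)) 1) ζ 0 :=
    ⟨_, ((hWs.differentiable (by simp)) _).hasFDerivAt.comp_hasDerivAt 0 hfnq⟩
  have hprod := (hasDerivAt_comp_curve (contDiff_derivMap hf) hU).fun_mul hζ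
  have hrel := hζ.fun_add (hasDerivAt_clm_curve prim hprod)
  have hrel0 := hrel.unique ((hasDerivAt_const (0 : ℝ) (1 : C0)).congr_of_eventuallyEq
    (Eventually.of_forall fun s => (hW _).2))
  have hmean := hasDerivAt_clm_curve mean hprod
  have hD : HasDerivAt (fun s : ℝ => partialFst (𝓜.height f S) (q₀ + s • d))
      (fderiv ℝ (partialFst (𝓜.height f S)) q₀ d) 0 := by
    have := (((contDiff_partialFst (𝓜.contDiff_height hf hS)).differentiable (by simp))
      (q₀ + (0 : ℝ) • d)).hasFDerivAt.comp_hasDerivAt 0 hq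
    simpa [Function.comp_def] using this
  have hval := hD.unique (hmean.congr_of_eventuallyEq (Eventually.of_forall fun s => (hW _).1))
  rw [zero_smul, add_zero] at hval hrel0
  have hw := (hW q₀).2
  have h0' := (hW q₀).1.symm.trans h0
  obtain ⟨s, hs⟩ := exists_ne_zero_along hf h2 hm (a := 0) (b := 1) one_ne_zero
  have hpos : 0 < mean (η * η) := mean_pos_of_nonneg (s := s) (fun s => mul_self_nonneg _) (by
    rw [zero_mul, zero_add, one_mul] at hs
    exact mul_ne_zero hs hs)
  -- `f'(u)` changes at the rate `f''(u₀) η = η²`, so the second order formula applies with `a =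
  -- η²`.
  have hx : ζ + prim ((derivMap f hf).comp u₀ * ζ + η * η * fderiv ℝ S (𝓜.fn q₀) 1) = 0 := by
    rw [← hrel0, add_comm ((derivMap f hf).comp u₀ * ζ)]
  have key := mean_mul_integral_expInt_of_mul hw h0' hx
  rw [← key, add_comm ((derivMap f hf).comp u₀ * ζ)] at hpos
  intro hzero
  rw [hval] at hzero
  exact hpos.ne' (mul_eq_zero_of_left hzero _)

/-- The hypotheses say that the first two vertical derivatives of `height` vanish at the point over
`u₀` and the third does not. The change of coordinates is global, so the charts are homeomorphisms.
-/
theorem exists_isCusp [CompleteSpace 𝓜.tilde] (hf : ContDiff ℝ ∞ f)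
    (h2 : IsGood 2 f) (hlim : Tendsto f (cocompact ℝ) atTop) {u₀ w₀ k : C0} {c : ℝ}
    (hu₀ : u₀ = ContinuousMap.const _ c + prim k)
    (hw₀ : w₀ + prim ((derivMap f hf).comp u₀ * w₀) = 1)
    (hc₁ : mean ((derivMap f hf).comp u₀ * w₀) = 0)
    (hc₂ : mean ((derivMap₂ hf).comp u₀ * w₀) = 0)
    (hc₃ : mean ((derivMap₃ hf).comp u₀ * w₀ * w₀) ≠ 0) :
    ∃ z : E, IsCusp (𝓜.op f) z := by
  obtain ⟨S, hS, h₁, h₂⟩ := exists_solution hlim hf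
  have hm : mean ((derivMap f hf).comp u₀) = 0 := by
    have h := mean_mul_integral_expInt_one hw₀
    rw [hc₁, zero_mul] at h
    rw [← Real.exp_eq_one_iff]
    linarith
  -- The projection of the image of `u₀`, so that `(c, v₀)` are the coordinates of `u₀`.
  set v₀ : 𝓜.tilde := 𝓜.proj (𝓜.incl (k + f.comp u₀)) with hv₀
  have hline0 : ContinuousMap.const _ c + 𝓜.primitive v₀ = addPrim f u₀ := by
    rw [hv₀, primitive_proj_incl, map_add prim, ← add_assoc, ← hu₀, addPrim]
  have hSu : S (ContinuousMap.const _ c + 𝓜.primitive v₀) = u₀ := by rw [hline0, h₂]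
  have hfn : S (𝓜.fn (c, v₀)) = u₀ := by rw [fn_apply, hSu]
  have hheight := 𝓜.contDiff_height hf hS
  have hu := contDiff_line hS (𝓜.primitive v₀)
  have hg := fun y => h₁ (ContinuousMap.const _ y + 𝓜.primitive v₀)
  have hI := integral_expInt_pos ((derivMap f hf).comp u₀)
  have hderiv : deriv (fun y : ℝ => S (ContinuousMap.const _ y + 𝓜.primitive v₀)) c = w₀ := by
    have h := deriv_line hf hu hg c
    rw [hSu] at h
    refine (linEquiv ((derivMap f hf).comp u₀)).injective ?_
    rw [← ContinuousLinearEquiv.coe_coe, coe_linEquiv]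
    exact h.trans hw₀.symm
  have d1 : deriv (fun y : ℝ => mean (f.comp (S (ContinuousMap.const _ y + 𝓜.primitive v₀)))) c
      = 0 := by
    rw [deriv_mean hf hu, hSu, hderiv, hc₁]
  have d2 : deriv (deriv fun y : ℝ =>
      mean (f.comp (S (ContinuousMap.const _ y + 𝓜.primitive v₀)))) c = 0 := by
    have h := deriv_mean_two_mul hf hu hg d1
    rw [hSu, hderiv, hc₂] at h
    exact (mul_eq_zero.mp h).resolve_right hI.ne'
  have d3 : deriv (deriv (deriv fun y : ℝ =>
      mean (f.comp (S (ContinuousMap.const _ y + 𝓜.primitive v₀))))) c ≠ 0 := by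
    intro h0
    have h := deriv_mean_three_mul hf hu hg d1 d2
    rw [hSu, hderiv, h0, zero_mul] at h
    exact hc₃ h.symm
  let Ψ := 𝓜.straighten h₁ h₂
  let e₁ : E ≃ₜ 𝓜.tilde × ℝ :=
    { toEquiv := 𝓜.coord.toEquiv.trans (Ψ.trans (Equiv.prodComm _ _))
      continuous_toFun := continuous_swap.comp
        ((𝓜.contDiff_straighten hf h₁ h₂).continuous.comp 𝓜.coord.continuous)
      continuous_invFun := 𝓜.coord.symm.continuous.comp
        ((𝓜.contDiff_straighten_symm hf hS h₁ h₂).continuous.comp continuous_swap) }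
  let e₀ : B ≃ₜ 𝓜.tilde × ℝ := 𝓜.split.toHomeomorph.trans (Homeomorph.prodComm _ _)
  have hswap : ContDiff ℝ ∞ (Prod.swap : 𝓜.tilde × ℝ → ℝ × 𝓜.tilde) :=
    contDiff_snd.prodMk contDiff_fst
  have hswap' : ContDiff ℝ ∞ (Prod.swap : ℝ × 𝓜.tilde → 𝓜.tilde × ℝ) :=
    contDiff_snd.prodMk contDiff_fst
  have hz : e₁ (e₁.symm (v₀, c)) = (v₀, c) := e₁.apply_symm_apply _
  refine ⟨e₁.symm (v₀, c), 𝓜.tilde, inferInstance, inferInstance, inferInstance,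
    e₁.toOpenPartialHomeomorph, e₀.toOpenPartialHomeomorph,
    fun p => 𝓜.height f S (p.2, p.1), ⟨mem_univ _, ?_, ?_⟩, ⟨mem_univ _, ?_, ?_⟩,
    fun _ _ => mem_univ _, ?_, ?_, ?_, ?_, ?_⟩
  · exact (hswap'.comp ((𝓜.contDiff_straighten hf h₁ h₂).comp 𝓜.coord.contDiff)).contDiffOn
  · exact (𝓜.coord.symm.contDiff.comp
      ((𝓜.contDiff_straighten_symm hf hS h₁ h₂).comp hswap)).contDiffOn
  · exact (hswap'.comp 𝓜.split.contDiff).contDiffOn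
  · exact (𝓜.split.symm.contDiff.comp hswap).contDiffOn
  · exact (hheight.comp hswap).contDiffOn
  · rintro ⟨v, y⟩ -
    exact congrArg Prod.swap (𝓜.split_op h₁ h₂ (y, v))
  · intro i hi hi'
    simp only [Homeomorph.toOpenPartialHomeomorph_apply, hz, height_apply]
    interval_cases i
    · rw [iteratedDeriv_one, d1]
    · rw [iteratedDeriv_succ, iteratedDeriv_one, d2]
  · simp only [Homeomorph.toOpenPartialHomeomorph_apply, hz, height_apply]
    rw [iteratedDeriv_succ, iteratedDeriv_succ, iteratedDeriv_one]
    exact d3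
  · simp only [Homeomorph.toOpenPartialHomeomorph_apply, hz]
    -- For order two, condition (c) has a single component, and surjectivity only asks for a nonzero
    -- differential.
    have hfun : (fun (p : 𝓜.tilde × ℝ) (i : Fin (2 - 1)) =>
        iteratedDeriv (i.val + 1) (fun y => 𝓜.height f S (y, p.1)) p.2)
        = fun p _ => partialFst (𝓜.height f S) p.swap := by
      ext p i
      fin_cases i
      simp only [zero_add, iteratedDeriv_one]
      exact (hasDerivAt_partialFst hheight p.2 p.1).deriv
    rw [hfun]
    obtain ⟨d, hd⟩ := 𝓜.exists_fderiv_partialFst_ne_zero hf h2 hS h₁ (q₀ := (c, v₀)) (c := c)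
      (k := k) (by rw [hfn, hu₀]) (by rw [hfn, hm])
      (by rw [𝓜.partialFst_height hf hS, d1])
    set A := fderiv ℝ (partialFst (𝓜.height f S)) (c, v₀) with hA
    have hder : HasFDerivAt (fun (p : 𝓜.tilde × ℝ) (_ : Fin (2 - 1)) =>
        partialFst (𝓜.height f S) p.swap)
        (ContinuousLinearMap.pi fun _ => A.comp
          ((ContinuousLinearMap.snd ℝ 𝓜.tilde ℝ).prod (ContinuousLinearMap.fst ℝ 𝓜.tilde ℝ)))
        (v₀, c) := by
      refine hasFDerivAt_pi.mpr fun _ => ?_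
      have h1 : HasFDerivAt (partialFst (𝓜.height f S)) A (Prod.swap (v₀, c)) :=
        (((contDiff_partialFst hheight).differentiable (by simp)) _).hasFDerivAt
      exact h1.comp (v₀, c) ((ContinuousLinearMap.snd ℝ 𝓜.tilde ℝ).prod
        (ContinuousLinearMap.fst ℝ 𝓜.tilde ℝ)).hasFDerivAt
    rw [hder.fderiv]
    intro b
    refine ⟨(b 0 / A d) • d.swap, ?_⟩
    ext i
    fin_cases i
    have : A ((b 0 / A d) • d) = b 0 := by
      rw [map_smul, smul_eq_mul, div_mul_cancel₀ _ hd]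
    exact this

end CircleModel

/-! ### The two function spaces -/

lemma C1.eq_const_add_prim (u : C1) :
    u.1.1 = ContinuousMap.const _ (u.1.1 ((0 : ℝ) : UnitAddCircle)) + prim u.1.2
      ∧ mean u.1.2 = 0 := PeriodicODE.eq_const_add_prim u.2

lemma mem_C0tilde (v : C0) : v ∈ C0tilde ↔ mean v = 0 := by
  rw [mean_eq_integral]; rfl

lemma const_add_prim_mem_C1 (y : ℝ) {v : C0} (hv : mean v = 0) :
    (ContinuousMap.const _ y + prim v, v) ∈ C1 := fun t => by
  have h := (hasDerivAt_prim v t).const_add y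
  rw [hv, sub_zero] at h
  exact h

/-- The space `C¹` in terms of initial values and derivatives. -/
noncomputable def C1.coord : C1 ≃L[ℝ] ℝ × C0tilde :=
  ContinuousLinearEquiv.equivOfInverse
    (((ContinuousMap.evalCLM ℝ ((0 : ℝ) : UnitAddCircle)).comp
      ((ContinuousLinearMap.fst ℝ C0 C0).comp C1.subtypeL)).prod
      (((ContinuousLinearMap.snd ℝ C0 C0).comp C1.subtypeL).codRestrict C0tilde fun u =>
        (mem_C0tilde _).mpr (C1.eq_const_add_prim u).2))
    (((((ContinuousLinearMap.fst ℝ ℝ C0tilde).smulRight (1 : C0)) +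
      (prim.comp (C0tilde.subtypeL.comp (ContinuousLinearMap.snd ℝ ℝ C0tilde)))).prod
      (C0tilde.subtypeL.comp (ContinuousLinearMap.snd ℝ ℝ C0tilde))).codRestrict C1 fun p => by
        have h := const_add_prim_mem_C1 p.1 ((mem_C0tilde _).mp p.2.2)
        convert! h using 2
        ext s
        simp)
    (fun u => by
      refine Subtype.ext (Prod.ext ?_ rfl)
      refine Eq.trans ?_ (C1.eq_const_add_prim u).1.symm
      ext s
      simp)
    (fun p => by
      refine Prod.ext ?_ rfl
      have := prim_zero (p.2 : C0)
      simpa using this)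

/-- The model for `C¹` and `C⁰`. -/
noncomputable def modelC : CircleModel C1 C0 where
  incl := ContinuousLinearMap.id ℝ C0
  avg := mean
  primitive := prim
  avg_incl _ := rfl
  primitive_incl _ := rfl
  tilde := C0tilde
  mem_tilde := mem_C0tilde
  coord := C1.coord

lemma modelC_op (f : C(ℝ, ℝ)) : modelC.op f = opC f := by
  funext u
  have h : modelC.fn (modelC.coord u) = u.1.1 := by
    rw [CircleModel.fn_apply]
    exact (C1.eq_const_add_prim u).1.symm
  rw [CircleModel.op, h]
  rfl

instance : CompleteSpace modelC.tilde := by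
  have h : IsClosed (modelC.tilde : Set C0) := by
    have : (modelC.tilde : Set C0) = {v | mean v = 0} := by
      ext v; exact mem_C0tilde v
    rw [this]
    exact isClosed_eq mean.continuous continuous_const
  exact h.completeSpace_coe

/-! ### The Sobolev model -/

lemma mem_H0tilde (v : H0) : v ∈ H0tilde ↔ meanH v = 0 := Iff.rfl

lemma H1.eq_const_add_primH (u : H1) :
    u.fn = ContinuousMap.const _ (u.fn ((0 : ℝ) : UnitAddCircle)) + primH u.der
      ∧ meanH u.der = 0 := by
  have h : ∀ t ∈ Icc (0 : ℝ) 1, u.fn (t : UnitAddCircle) = u.fn ((0 : ℝ) : UnitAddCircle)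
      + ∫ s in (0 : ℝ)..t, u.der (s : UnitAddCircle) := u.2
  have hm : meanH u.der = 0 := by
    have h1 := h 1 ⟨zero_le_one, le_rfl⟩
    rw [coe_one_circle] at h1
    rw [meanH_eq]
    linarith
  refine ⟨C0.ext_Icc fun t ht => ?_, hm⟩
  rw [ContinuousMap.add_apply, primH_apply _ ht, hm, h t ht]
  simp

lemma const_add_primH_mem_H1pairs (y : ℝ) {v : H0} (hv : meanH v = 0) :
    (ContinuousMap.const _ y + primH v, v) ∈ H1pairs := fun t ht => by
  simp only [ContinuousMap.add_apply, ContinuousMap.const_apply]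
  rw [primH_zero, primH_apply _ ht, hv]
  simp

lemma H1.isometry_toL2 : Isometry H1.toL2 := AddMonoidHomClass.isometry_of_norm _ fun _ => rfl

/-- The pair formed by a function in `H¹` and its derivative, as elements of `L²`. -/
noncomputable def H1.pairL : H1 →L[ℝ] H0 × H0 :=
  (WithLp.prodContinuousLinearEquiv 2 ℝ H0 H0 : WithLp 2 (H0 × H0) →L[ℝ] H0 × H0).comp
    ⟨H1.toL2, H1.isometry_toL2.continuous⟩

/-- The value at `0` of a function in `H¹`. -/
noncomputable def H1.valueZero : H1 →L[ℝ] ℝ :=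
  meanH.comp ((ContinuousLinearMap.fst ℝ H0 H0).comp H1.pairL)
    - (mean.comp primH).comp ((ContinuousLinearMap.snd ℝ H0 H0).comp H1.pairL)

/-- Averaging `u = u(0) + primH u'` expresses `u(0)` through quantities that are continuous for the
Hilbert norm; this replaces the Sobolev embedding. -/
lemma H1.valueZero_apply (u : H1) : H1.valueZero u = u.fn ((0 : ℝ) : UnitAddCircle) := by
  change mean u.fn - mean (primH u.der) = _
  conv_lhs => rw [u.eq_const_add_primH.1, map_add, add_sub_cancel_right]
  rw [mean_eq]
  simp

/-- The element of `H¹` with given value at `0` and given derivative. -/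
noncomputable def H1.ofCoord : ℝ × H0tilde →ₗ[ℝ] H1 :=
  LinearMap.codRestrict H1pairs
    ((((ContinuousLinearMap.fst ℝ ℝ H0tilde).smulRight (1 : C0)) +
      (primH.comp (H0tilde.subtypeL.comp (ContinuousLinearMap.snd ℝ ℝ H0tilde)))).prod
      (H0tilde.subtypeL.comp (ContinuousLinearMap.snd ℝ ℝ H0tilde)) :
      ℝ × H0tilde →L[ℝ] C0 × H0).toLinearMap fun p => by
        have h := const_add_primH_mem_H1pairs p.1 ((mem_H0tilde _).mp p.2.2)
        convert! h using 2
        ext s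
        simp

lemma H1.fn_ofCoord (p : ℝ × H0tilde) : (H1.ofCoord p).fn = p.1 • (1 : C0) + primH p.2 := rfl

lemma H1.continuous_ofCoord : Continuous H1.ofCoord := by
  rw [H1.isometry_toL2.isUniformInducing.isInducing.continuous_iff]
  have h : (H1.toL2 ∘ H1.ofCoord : ℝ × H0tilde → WithLp 2 (H0 × H0)) =
      fun p => WithLp.toLp 2 (inclH (p.1 • (1 : C0) + primH p.2), (p.2 : H0)) := rfl
  rw [h]
  exact (WithLp.prod_continuous_toLp 2 H0 H0).comp (by fun_prop)

/-- The space `H¹` in terms of initial values and derivatives. -/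
noncomputable def H1.coord : H1 ≃L[ℝ] ℝ × H0tilde :=
  ContinuousLinearEquiv.equivOfInverse
    (H1.valueZero.prod
      (((ContinuousLinearMap.snd ℝ H0 H0).comp H1.pairL).codRestrict H0tilde fun u =>
        u.eq_const_add_primH.2))
    ⟨H1.ofCoord, H1.continuous_ofCoord⟩
    (fun u => by
      refine Subtype.ext (Prod.ext ?_ rfl)
      refine Eq.trans ?_ u.eq_const_add_primH.1.symm
      rw [← H1.valueZero_apply]
      change H1.valueZero u • (1 : C0) + _ = _
      congr 1
      ext s
      simp)
    (fun p => by
      refine Prod.ext ?_ rfl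
      change H1.valueZero (H1.ofCoord p) = p.1
      rw [H1.valueZero_apply, H1.fn_ofCoord, ContinuousMap.add_apply, primH_zero]
      simp)

/-- The model for `H¹` and `L²`. -/
noncomputable def modelH : CircleModel H1 H0 where
  incl := inclH
  avg := meanH
  primitive := primH
  avg_incl _ := rfl
  primitive_incl _ := rfl
  tilde := H0tilde
  mem_tilde := mem_H0tilde
  coord := H1.coord

lemma modelH_op (f : C(ℝ, ℝ)) : modelH.op f = opH f := by
  funext u
  have h : modelH.fn (modelH.coord u) = u.fn := by
    rw [CircleModel.fn_apply]
    change ContinuousMap.const _ (H1.valueZero u) + primH u.der = u.fn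
    rw [H1.valueZero_apply]
    exact u.eq_const_add_primH.1.symm
  rw [CircleModel.op, h]
  rfl

instance : CompleteSpace modelH.tilde := by
  have h : IsClosed (modelH.tilde : Set H0) := by
    have : (modelH.tilde : Set H0) = {v | meanH v = 0} := by
      ext v; exact mem_H0tilde v
    rw [this]
    exact isClosed_eq meanH.continuous continuous_const
  exact h.completeSpace_coe

end PeriodicODE

theorem theorem4p3 (f : ℝ → ℝ) (hf : ContDiff ℝ ∞ f)
    (h2 : PeriodicODE.IsGood 2 f) (h3 : PeriodicODE.IsGood 3 f)
    (htop : Tendsto f atTop atTop) (hbot : Tendsto f atBot atTop) :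
    ((0 : Fin 2 → ℝ) ∈ interior (convexHull ℝ (range (PeriodicODE.gammaHat 2 f))) →
      (∃ u : PeriodicODE.C1, PeriodicODE.IsCusp (PeriodicODE.opC ⟨f, hf.continuous⟩) u) ∧
      (∃ u : PeriodicODE.H1, PeriodicODE.IsCusp (PeriodicODE.opH ⟨f, hf.continuous⟩) u)) ∧
    ((0 : Fin 2 → ℝ) ∉ interior (convexHull ℝ (range (PeriodicODE.gammaHat 2 f))) →
      PeriodicODE.IsGlobalFold PeriodicODE.C0tilde (PeriodicODE.opC ⟨f, hf.continuous⟩) ∧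
      PeriodicODE.IsGlobalFold PeriodicODE.H0tilde (PeriodicODE.opH ⟨f, hf.continuous⟩)) := by
  let g : C(ℝ, ℝ) := ⟨f, hf.continuous⟩
  have hg : ContDiff ℝ ∞ g := hf
  have hlim : Tendsto g (cocompact ℝ) atTop := by
    rw [cocompact_eq_atBot_atTop]
    exact tendsto_sup.mpr ⟨hbot, htop⟩
  rw [← PeriodicODE.modelC_op, ← PeriodicODE.modelH_op]
  refine ⟨fun h => ?_, fun h => ?_⟩
  -- The data consist of continuous functions, so the same ones serve both models.
  · obtain ⟨u₀, w₀, k, c, e1, e2, e3, e4, e5⟩ := PeriodicODE.exists_cusp_data hg h3 h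
    exact ⟨PeriodicODE.modelC.exists_isCusp hg h2 hlim e1 e2 e3 e4 e5,
      PeriodicODE.modelH.exists_isCusp hg h2 hlim e1 e2 e3 e4 e5⟩
  · exact ⟨PeriodicODE.modelC.isGlobalFold hg h2 hlim h,
      PeriodicODE.modelH.isGlobalFold hg h2 hlim h⟩
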